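/- **Proposition (DEA convergence).** Let $\Gamma$ be a finite two-player zero-sum extensive-form game with information sets $\mathcal I_0\cup\mathcal I_1$ and legal action sets $A(h)$, in which player 1 (the opponent) has perfect recall. Let $\mathcal M$ be a mask: for every information set $h\in\mathcal I_0$ of player 0 (the victim), a nonempty set $\mathcal M(h)\subseteq A(h)$ of retained actions. Both players repeatedly play the masked game and learn by tabular undiscounted Q-learning, starting from an arbitrary table $Q_0$. In each episode both play $\varepsilon$-greedily for the current table among their available actions ($0<\varepsilon\le 1$, ties broken by any, possibly random, rule). For each pair $(h,a)$ played by a player, $Q(h,a)\leftarrow Q(h,a)+\alpha_n\,(y-Q(h,a))$, where $y$ is the maximum of $Q(h',\cdot)$ over the available actions at the player's next information set $h'$ in the episode, or the player's final payoff if there is none, and $\alpha_n\in(0,1)$ is the step size of the $n$-th update of $(h,a)$. Assume that $$\mathrm{CAC}_w(\mathcal M)=\sum_{h\in\mathcal I_0}\rho(h)\,\mathbf 1[|\mathcal M(h)|>1]=0,$$ where $\rho(h)$ is the probability that an episode of the initial $\varepsilon$-greedy play passes through $h$. Let $\sigma^*$ be a pure strategy of the victim with $\sigma^*(h)\in\mathcal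 M(h)$ for all $h$. A *best response* to $\sigma^*$ is a strategy of player 1 that maximises its expected payoff, both in the whole game and conditionally from each of its information sets $h$ that can be reached against $\sigma^*$ (below: *reachable* $h$). Then $\mathrm{BR}(\sigma^*)$, the set of best responses, is nonempty, and for every $\tau^*\in\mathrm{BR}(\sigma^*)$, with $Q^*(h,a)$ the conditional expected payoff of player 1 given that $h$ is reached, $a$ is played there, and $(\sigma^*,\tau^*)$ is followed afterwards: (i) $\mathcal M(h)=\{\sigma^*(h)\}$ at every victim information set that has positive probability of being reached in the play of any episode; and at every $h$ with $\mathcal M(h)=\{\sigma^*(h)\}$ the victim's policy converges to the forced action $\sigma^*(h)$. (ii) If $\sum_n\alpha_n=\infty$ and $\sum_n\alpha_n^2<\infty$, then almost surely the opponent's Q-values converge to $Q^*(h,a)$ for all reachable $h\in\mathcal I_1$ and all $a\in A(h)$. (iii) $(\sigma^*,\mathrm{BR}(\sigma^*))$ is a stable fixed point: in the masked game neither player gains by deviating unilaterally from $(\sigma^*,\tau^*)$; the strategies of player 1 that are greedy for $Q^*$ at all reachable information sets are exactly the elements of $\mathrm{BR}(\sigma^*)$; for every constant step size $c\in(0,1)$,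 the map that sends a table to the expected table after one more episode of $\varepsilon$-greedy play fixes the opponent's values $Q^*$ on the reachable pairs $(h,a)$, its iterates never increase the largest distance from $Q^*$ over these pairs beyond its initial value, and they converge to $Q^*$ on these pairs from every initial table; and, under the step-size conditions of (ii), almost surely, for all sufficiently late episodes, every strategy of player 1 that is greedy for the current Q-values at all reachable information sets is in $\mathrm{BR}(\sigma^*)$. -/

import Mathlib

open MeasureTheory ProbabilityTheory Filter Topology
open scoped NNReal ENNReal

namespace MaskedSelfPlay

noncomputable section

/-- Finite two-player game trees. `I₀` and `I₁` are the information sets of player 0 (the victim)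
and of player 1 (the opponent), `A` is the set of actions. A leaf carries the payoff of player 0;
the game is zero-sum, so player 1 receives its negative. The subtrees of a decision node at actions
that are not legal there are never used. -/
inductive Tree (I₀ I₁ A : Type*) where
  | leaf (u : ℝ) : Tree I₀ I₁ A
  | chance (n : ℕ) (p : PMF (Fin n)) (next : Fin n → Tree I₀ I₁ A) : Tree I₀ I₁ A
  | decision (h : I₀ ⊕ I₁) (next : A → Tree I₀ I₁ A) : Tree I₀ I₁ A

/-- A two-player zero-sum extensive-form game: a tree, whose decision nodes are labelled with
information sets, and the nonempty set of legal actions of every information set. -/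
structure Game (I₀ I₁ A : Type*) where
  root : Tree I₀ I₁ A
  legal : I₀ ⊕ I₁ → Finset A
  legal_nonempty : ∀ h, (legal h).Nonempty

/-- An action-removal mask: at every victim information set, a nonempty set of retained legal
actions. -/
structure Mask {I₀ I₁ A : Type*} (G : Game I₀ I₁ A) where
  keep : I₀ → Finset A
  keep_nonempty : ∀ h, (keep h).Nonempty
  keep_subset : ∀ h, keep h ⊆ G.legal (Sum.inl h)

variable {I₀ I₁ A : Type*}

/-- `Leads legal T l T'`: the node `T'` is reached from `T` by the legal moves `l`
(and arbitrary outcomes of the chance nodes on the way). -/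
inductive Leads (legal : I₀ ⊕ I₁ → Finset A) :
    Tree I₀ I₁ A → List ((I₀ ⊕ I₁) × A) → Tree I₀ I₁ A → Prop
  | here (T : Tree I₀ I₁ A) : Leads legal T [] T
  | chance (n : ℕ) (p : PMF (Fin n)) (next : Fin n → Tree I₀ I₁ A) (i : Fin n)
      (l : List ((I₀ ⊕ I₁) × A)) (T' : Tree I₀ I₁ A) :
      Leads legal (next i) l T' → Leads legal (Tree.chance n p next) l T'
  | move (h : I₀ ⊕ I₁) (next : A → Tree I₀ I₁ A) (a : A)
      (l : List ((I₀ ⊕ I₁) × A)) (T' : Tree I₀ I₁ A) :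
      a ∈ legal h → Leads legal (next a) l T' →
        Leads legal (Tree.decision h next) ((h, a) :: l) T'

/-- The part of a list of moves that was made by player 1. -/
def ownMoves₁ (l : List ((I₀ ⊕ I₁) × A)) : List (I₁ × A) :=
  l.filterMap fun m => match m with
    | (Sum.inr h, a) => some (h, a)
    | (Sum.inl _, _) => none

/-- Perfect recall of player 1: any two nodes in the same information set of player 1 are preceded
by the same sequence of own information sets and own actions. -/
def Game.PerfectRecall₁ (G : Game I₀ I₁ A) : Prop :=
  ∀ (h : I₁) (l l' : List ((I₀ ⊕ I₁) × A)) (f f' : A → Tree I₀ I₁ A),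
    Leads G.legal G.root l (Tree.decision (Sum.inr h) f) →
    Leads G.legal G.root l' (Tree.decision (Sum.inr h) f') →
    ownMoves₁ l = ownMoves₁ l'

/-! ### Strategies, payoffs and best responses -/

/-- A behaviour strategy (a distribution over actions at every `x`) that only uses the actions
in `S x`. -/
def Respects {X : Type*} (S : X → Finset A) (σ : X → PMF A) : Prop :=
  ∀ x, ∀ a ∈ (σ x).support, a ∈ S x

/-- The pure strategy that plays `s x` at `x`. -/
def pureStrategy {X : Type*} (s : X → A) : X → PMF A := fun x => PMF.pure (s x)

/-- Legal actions of player 1. -/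
def Game.legal₁ (G : Game I₀ I₁ A) : I₁ → Finset A := fun h => G.legal (Sum.inr h)

/-- Expected payoff of player 0 in the tree when the two players use the profile `π`. -/
def Tree.value [Fintype A] (π : I₀ ⊕ I₁ → PMF A) : Tree I₀ I₁ A → ℝ
  | .leaf u => u
  | .chance _ p next => ∑ i, (p i).toReal * (next i).value π
  | .decision h next => ∑ a, (π h a).toReal * (next a).value π

/-- The sum of `F` over all nodes of the information set `h` of player 1, each weighted with the
probability with which chance and player 0 (who uses `σ`) play towards that node. `F` is given the
continuations of the node. -/
def Tree.nodeSum [Fintype A] [DecidableEq I₁] (legal₁ : I₁ → Finset A) (σ : I₀ → PMF A) (h : I₁)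
    (F : (A → Tree I₀ I₁ A) → ℝ) : Tree I₀ I₁ A → ℝ
  | .leaf _ => 0
  | .chance _ p next => ∑ i, (p i).toReal * (next i).nodeSum legal₁ σ h F
  | .decision (.inl k) next => ∑ a, (σ k a).toReal * (next a).nodeSum legal₁ σ h F
  | .decision (.inr k) next =>
      if k = h then F next else ∑ a ∈ legal₁ k, (next a).nodeSum legal₁ σ h F

section BestResponse

variable [Fintype A] [DecidableEq I₁]

/-- The weight with which the information set `h` of player 1 is reached against the strategy `σ`
of player 0, when player 1 plays towards `h`. -/
def Game.reachWeight (G : Game I₀ I₁ A) (σ : I₀ → PMF A) (h : I₁) : ℝ :=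
  G.root.nodeSum G.legal₁ σ h fun _ => 1

/-- The information set `h` of player 1 can be reached against `σ`. -/
def Game.Reachable₁ (G : Game I₀ I₁ A) (σ : I₀ → PMF A) (h : I₁) : Prop :=
  0 < G.reachWeight σ h

/-- Action value of player 1: its conditional expected payoff, given that `h` has been reached, if
it plays `a` at `h` and `τ` afterwards, and player 0 uses `σ`. -/
def Game.actionValue (G : Game I₀ I₁ A) (σ : I₀ → PMF A) (τ : I₁ → PMF A) (h : I₁) (a : A) : ℝ :=
  -(G.root.nodeSum G.legal₁ σ h fun next => (next a).value (Sum.elim σ τ)) / G.reachWeight σ h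

/-- Conditional expected payoff of player 1, given that `h` has been reached, if it plays `τ` from
there on, and player 0 uses `σ`. -/
def Game.infoValue (G : Game I₀ I₁ A) (σ : I₀ → PMF A) (τ : I₁ → PMF A) (h : I₁) : ℝ :=
  ∑ a, (τ h a).toReal * G.actionValue σ τ h a

/-- Expected payoffs of the two players under a strategy profile. -/
def Game.payoff₀ (G : Game I₀ I₁ A) (σ : I₀ → PMF A) (τ : I₁ → PMF A) : ℝ :=
  G.root.value (Sum.elim σ τ)

def Game.payoff₁ (G : Game I₀ I₁ A) (σ : I₀ → PMF A) (τ : I₁ → PMF A) : ℝ :=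
  -G.root.value (Sum.elim σ τ)

/-- `τ` is a best response of player 1 to `σ`: it maximises the expected payoff of player 1 in the
whole game, and also its conditional expected payoff from every information set on that can be
reached against `σ`. -/
structure Game.IsBestResponse (G : Game I₀ I₁ A) (σ : I₀ → PMF A) (τ : I₁ → PMF A) : Prop where
  legal : Respects G.legal₁ τ
  overall : ∀ τ', Respects G.legal₁ τ' → G.payoff₁ σ τ' ≤ G.payoff₁ σ τ
  sequential : ∀ h, G.Reachable₁ σ h → ∀ τ', Respects G.legal₁ τ' →
    G.infoValue σ τ' h ≤ G.infoValue σ τ h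

end BestResponse

/-! ### Self-play Q-learning under a mask -/

/-- A table of Q-values for both players. -/
abbrev Table (I₀ I₁ A : Type*) := I₀ ⊕ I₁ → A → ℝ

/-- The available actions in the masked game. -/
def Mask.avail {G : Game I₀ I₁ A} (M : Mask G) : I₀ ⊕ I₁ → Finset A :=
  Sum.elim M.keep G.legal₁

theorem Mask.avail_nonempty {G : Game I₀ I₁ A} (M : Mask G) (h : I₀ ⊕ I₁) :
    (M.avail h).Nonempty := by
  cases h with
  | inl h => exact M.keep_nonempty h
  | inr h => exact G.legal_nonempty (Sum.inr h)

/-- `a` is a greedy action at `h` with respect to the table `Q`. -/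
def Mask.IsGreedyAt {G : Game I₀ I₁ A} (M : Mask G) (Q : Table I₀ I₁ A) (h : I₀ ⊕ I₁) (a : A) :
    Prop :=
  a ∈ M.avail h ∧ ∀ b ∈ M.avail h, Q h b ≤ Q h a

/-- A rule for the choice of a greedy action, with an arbitrary, possibly random, way of breaking
ties. -/
structure GreedyRule {G : Game I₀ I₁ A} (M : Mask G) where
  choose : Table I₀ I₁ A → I₀ ⊕ I₁ → PMF A
  greedy : ∀ Q h, ∀ a ∈ (choose Q h).support, M.IsGreedyAt Q h a

/-- The `ε`-greedy strategy of both players for the table `Q`: with probability `ε` a uniformly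
random available action, otherwise a greedy one. -/
def epsGreedy {G : Game I₀ I₁ A} {M : Mask G} (g : GreedyRule M) (ε : ℝ≥0) (hε : ε ≤ 1)
    (Q : Table I₀ I₁ A) (h : I₀ ⊕ I₁) : PMF A :=
  (PMF.ofFintype (fun b : Bool => cond b (ε : ℝ≥0∞) (1 - ε)) (by simp [hε])).bind fun explore =>
    if explore then PMF.uniformOfFinset (M.avail h) (M.avail_nonempty h) else g.choose Q h

/-- The record of one played episode: the outcomes of the chance nodes and the moves, in their
order. -/
def Episode (I₀ I₁ A : Type*) := List (ℕ ⊕ ((I₀ ⊕ I₁) × A))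

instance : MeasurableSpace (Episode I₀ I₁ A) := ⊤

instance : DiscreteMeasurableSpace (Episode I₀ I₁ A) := ⟨fun _ => trivial⟩

instance [Countable I₀] [Countable I₁] [Countable A] : Countable (Episode I₀ I₁ A) :=
  inferInstanceAs (Countable (List (ℕ ⊕ ((I₀ ⊕ I₁) × A))))

/-- The distribution of an episode that is played with the profile `π`. -/
def Tree.law (π : I₀ ⊕ I₁ → PMF A) : Tree I₀ I₁ A → PMF (Episode I₀ I₁ A)
  | .leaf _ => PMF.pure []
  | .chance _ p next => p.bind fun i => ((next i).law π).map (List.cons (Sum.inl (i : ℕ)))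
  | .decision h next => (π h).bind fun a => ((next a).law π).map (List.cons (Sum.inr (h, a)))

/-- The payoff of player 0 at the end of an episode. -/
def Tree.outcome : Tree I₀ I₁ A → List (ℕ ⊕ ((I₀ ⊕ I₁) × A)) → ℝ
  | .leaf u, _ => u
  | .chance n _ next, .inl i :: l => if hi : i < n then (next ⟨i, hi⟩).outcome l else 0
  | .decision _ next, .inr (_, a) :: l => (next a).outcome l
  | _, _ => 0

/-- The probability that an episode played with `π` passes through the information set `h`. -/
def Game.reachProb (G : Game I₀ I₁ A) (π : I₀ ⊕ I₁ → PMF A) (h : I₀ ⊕ I₁) : ℝ :=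
  ((G.root.law π).toMeasure
    {e | ∃ a, (Sum.inr (h, a) : ℕ ⊕ ((I₀ ⊕ I₁) × A)) ∈
      (show List (ℕ ⊕ ((I₀ ⊕ I₁) × A)) from e)}).toReal

/-- Reach-weighted contingent action capacity of the mask when the current play is `π`. -/
def Mask.CACw [Fintype I₀] {G : Game I₀ I₁ A} (M : Mask G) (π : I₀ ⊕ I₁ → PMF A) : ℝ :=
  ∑ h : I₀, G.reachProb π (Sum.inl h) * if 1 < (M.keep h).card then 1 else 0

/-- The moves of one player in an episode. -/
def movesOf (isOwn : I₀ ⊕ I₁ → Bool) (e : List (ℕ ⊕ ((I₀ ⊕ I₁) × A))) :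
    List ((I₀ ⊕ I₁) × A) :=
  e.filterMap fun x => match x with
    | .inl _ => none
    | .inr m => if isOwn m.1 then some m else none

/-- The memory of the learner: its Q-values, and how often each of them has been updated. -/
structure Memory (I₀ I₁ A : Type*) where
  Q : Table I₀ I₁ A
  visits : I₀ ⊕ I₁ → A → ℕ

section Learning

variable [DecidableEq I₀] [DecidableEq I₁] [DecidableEq A]

/-- Move the Q-value of `(h, a)` towards `target`, with step size `α n` at its update number
`n = 0, 1, 2, …`. -/
def Memory.step (α : ℕ → ℝ) (m : Memory I₀ I₁ A) (h : I₀ ⊕ I₁) (a : A) (target : ℝ) :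
    Memory I₀ I₁ A where
  Q := Function.update m.Q h (Function.update (m.Q h) a
    (m.Q h a + α (m.visits h a) * (target - m.Q h a)))
  visits := Function.update m.visits h (Function.update (m.visits h) a (m.visits h a + 1))

variable {G : Game I₀ I₁ A} (M : Mask G)

/-- The (undiscounted) Q-learning updates of one player after an episode with own moves `l` and own
final payoff `u`: the target of a move is the largest Q-value of an available action at the next
own information set, and `u` for the last own move. -/
def Memory.learn (α : ℕ → ℝ) (u : ℝ) :
    Memory I₀ I₁ A → List ((I₀ ⊕ I₁) × A) → Memory I₀ I₁ A
  | m, [] => m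
  | m, [(h, a)] => m.step α h a u
  | m, (h, a) :: (h', a') :: l =>
      Memory.learn α u (m.step α h a ((M.avail h').sup' (M.avail_nonempty h') (m.Q h')))
        ((h', a') :: l)

/-- The updates of both players after an episode. -/
def Memory.afterEpisode (α : ℕ → ℝ) (m : Memory I₀ I₁ A) (e : Episode I₀ I₁ A) :
    Memory I₀ I₁ A :=
  Memory.learn M α (-G.root.outcome e)
    (Memory.learn M α (G.root.outcome e) m (movesOf Sum.isLeft e))
    (movesOf Sum.isRight e)

/-- The memory before episode number `t = 0, 1, 2, …` of a training run, if the run starts with the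
table `Q₀` and its episodes are `ω 0, ω 1, …`. -/
def memoryAt (α : ℕ → ℝ) (Q₀ : Table I₀ I₁ A) (ω : ℕ → Episode I₀ I₁ A) :
    ℕ → Memory I₀ I₁ A
  | 0 => ⟨Q₀, fun _ _ => 0⟩
  | t + 1 => (memoryAt α Q₀ ω t).afterEpisode M α (ω t)

variable {M}
variable (g : GreedyRule M) (ε : ℝ≥0) (hε : ε ≤ 1) (α : ℕ → ℝ) (Q₀ : Table I₀ I₁ A)

/-- The strategies that both players use in episode number `t`. -/
def playAt (ω : ℕ → Episode I₀ I₁ A) (t : ℕ) : I₀ ⊕ I₁ → PMF A :=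
  epsGreedy g ε hε (memoryAt M α Q₀ ω t).Q

/-- A finite history of episodes, continued by empty records. -/
def extend {t : ℕ} (x : (i : Finset.Iic t) → Episode I₀ I₁ A) : ℕ → Episode I₀ I₁ A :=
  fun i => if hi : i ≤ t then x ⟨i, Finset.mem_Iic.2 hi⟩ else ([] : List _)

section Law

variable [Countable I₀] [Countable I₁] [Countable A]

/-- The transition kernel of training: the distribution of episode `t + 1`, given the episodes
`0, …, t`. -/
def nextEpisode (t : ℕ) : Kernel ((_ : Finset.Iic t) → Episode I₀ I₁ A) (Episode I₀ I₁ A) where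
  toFun x := (G.root.law (playAt g ε hε α Q₀ (extend x) (t + 1))).toMeasure
  measurable' := Measurable.of_discrete

instance (t : ℕ) : IsMarkovKernel (nextEpisode g ε hε α Q₀ t) :=
  ⟨fun x => PMF.toMeasure.isProbabilityMeasure
    (G.root.law (playAt g ε hε α Q₀ (extend x) (t + 1)))⟩

/-- The distribution of the sequence of all episodes of self-play training. -/
def trainingLaw : Measure (ℕ → Episode I₀ I₁ A) :=
  (((G.root.law (epsGreedy g ε hε Q₀)).toMeasure).map
      (fun e (_ : Finset.Iic 0) => e)).bind
    (Kernel.traj (X := fun _ => Episode I₀ I₁ A) (nextEpisode g ε hε α Q₀) 0)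

end Law

/-- The expected table after one more episode with the constant step size `c`, when the present
table is `Q`. -/
def meanUpdate (c : ℝ) (Q : Table I₀ I₁ A) : Table I₀ I₁ A := fun h a =>
  ∫ e, ((Memory.mk Q fun _ _ => 0).afterEpisode M (fun _ => c) e).Q h a
    ∂(G.root.law (epsGreedy g ε hε Q)).toMeasure

end Learning

/-- The strategy `τ` of player 1 only uses greedy actions for the values `q`, at the information
sets that can be reached against `σ`. -/
def Game.IsGreedyStrategy [Fintype A] [DecidableEq I₁] (G : Game I₀ I₁ A) (σ : I₀ → PMF A)
    (q : I₁ → A → ℝ) (τ : I₁ → PMF A) : Prop :=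
  Respects G.legal₁ τ ∧ ∀ h, G.Reachable₁ σ h →
    ∀ a ∈ (τ h).support, ∀ b ∈ G.legal₁ h, q h b ≤ q h a

/-- The Robbins–Monro conditions on step sizes. -/
def RobbinsMonro (α : ℕ → ℝ) : Prop :=
  Tendsto (fun n => ∑ i ∈ Finset.range n, α i) atTop atTop ∧ Summable fun n => α n ^ 2

end

end MaskedSelfPlay

/-! The mask removes the non-stationarity of self-play. Exploration gives every available action
positive probability, so the initial play reaches every node that is compatible with the mask
(through chance outcomes of positive probability). Zero capacity therefore makes the mask a
singleton at every victim information set met in any masked play, whatever the tables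
(`forced_of_CACw_eq_zero`). Hence the law of an episode is the law of play against the fixed pure
strategy `s`, and it depends on the table only through the opponent's own exploration
(`Tree.Forced.law_eq`).

Against a fixed victim, perfect recall turns the opponent's problem into a finite-horizon Markov
decision process. An information set `h` has one own history `seq h`; the next information sets
after `(h, a)` are those with history `seq h ++ [(h, a)]`, and the transition weight to `k` is
`reachWeight k / reachWeight h`, which does not involve the opponent's strategy (`Game.bellman_eq`).
Backward induction on the length of the history yields a solution `V` of the optimality equation.
Best responses are exactly the strategies that are greedy for `G.bellman σ V`, and their action
values agree with `G.bellman σ V` at legal actions.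

For the learner, the own part of the probability of reaching `(h, a)` is the same at all nodes of
`h`. The expected increment of the Q-value is therefore the step size times a visit probability
times (Bellman value minus Q-value), and the visit probability is bounded below uniformly in the
table. So each Q-value is averaged towards the Bellman value of the current table, plus a martingale
increment. The noise is summable almost surely because the squared steps are summable, and the
weights diverge because every reachable pair is visited infinitely often. There is no discount and
no contraction; none is needed, because the Bellman value at `h` involves only later information
sets, so convergence passes backwards through the tree (`Game.IsOptimal.tendsto_tables`). The
expected update obeys the same recursion without noise, and it is nonexpansive because transition
weights sum to at most one (`Game.sum_reachWeight_le`). Limits preserve strict inequalities between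
finitely many Q-values, so late greedy strategies are best responses. -/

namespace MaskedSelfPlay

noncomputable section

variable {I₀ I₁ A : Type*}

/-! ### Perfect recall along the tree -/

section Recall

/-- Below the own moves `pre`, every information set `k` of player 1 that occurs in the tree is
preceded by exactly the own moves `seq k`. -/
def Tree.Recalls (G : Game I₀ I₁ A) (seq : I₁ → List (I₁ × A)) :
    Tree I₀ I₁ A → List (I₁ × A) → Prop
  | .leaf _, _ => True
  | .chance _ _ next, pre => ∀ i, (next i).Recalls G seq pre
  | .decision (.inl k) next, pre => ∀ a ∈ G.legal (.inl k), (next a).Recalls G seq pre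
  | .decision (.inr k) next, pre =>
      seq k = pre ∧ ∀ a ∈ G.legal₁ k, (next a).Recalls G seq (pre ++ [(k, a)])

theorem Tree.recalls_of_leads {G : Game I₀ I₁ A} {seq : I₁ → List (I₁ × A)} :
    ∀ (T : Tree I₀ I₁ A) (pre : List (I₁ × A)),
      (∀ l k f, Leads G.legal T l (.decision (.inr k) f) → seq k = pre ++ ownMoves₁ l) →
        T.Recalls G seq pre := by
  intro T
  induction T with
  | leaf u => intro _ _; trivial
  | chance n p next ih =>
    intro pre H i
    exact ih i pre fun l k f hl => H l k f (.chance n p next i l _ hl)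
  | decision h next ih =>
    intro pre H
    cases h with
    | inl k =>
      intro a ha
      refine ih a pre fun l k' f hl => ?_
      have := H _ k' f (.move (.inl k) next a l _ ha hl)
      simpa [ownMoves₁] using this
    | inr k =>
      refine ⟨by simpa [ownMoves₁] using H [] k next (.here _), fun a ha => ?_⟩
      refine ih a _ fun l k' f hl => ?_
      have := H _ k' f (.move (.inr k) next a l _ ha hl)
      simpa [ownMoves₁] using this

theorem Game.PerfectRecall₁.exists_recalls {G : Game I₀ I₁ A} (hG : G.PerfectRecall₁) :
    ∃ seq, G.root.Recalls G seq [] := by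
  classical
  -- The value `[]` at information sets that no legal play meets is immaterial: `Recalls` constrains
  -- only nodes reached by legal moves.
  refine ⟨fun k => if H : ∃ l f, Leads G.legal G.root l (.decision (.inr k) f) then
    ownMoves₁ H.choose else [], Tree.recalls_of_leads _ _ fun l k f hl => ?_⟩
  have H : ∃ l f, Leads G.legal G.root l (.decision (.inr k) f) := ⟨l, f, hl⟩
  obtain ⟨f', hf'⟩ := H.choose_spec
  simp only [dif_pos H, List.nil_append]
  exact hG k _ _ _ _ hf' hl

end Recall

/-! ### Continuation values -/

/-- Expected value of player 1, if the play of player 1 stops at its next information set `k`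
with the value that `F k` assigns to the continuations of the node. -/
def Tree.nextVal [Fintype A] (σ : I₀ → PMF A) (F : I₁ → (A → Tree I₀ I₁ A) → ℝ) : Tree I₀ I₁ A → ℝ
  | .leaf u => -u
  | .chance _ p next => ∑ i, (p i).toReal * (next i).nextVal σ F
  | .decision (.inl k) next => ∑ a, (σ k a).toReal * (next a).nextVal σ F
  | .decision (.inr k) next => F k next

theorem Tree.nextVal_value [Fintype A] (σ : I₀ → PMF A) (τ : I₁ → PMF A) (T : Tree I₀ I₁ A) :
    T.nextVal σ (fun k next => -∑ a, (τ k a).toReal * (next a).value (Sum.elim σ τ))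
      = -T.value (Sum.elim σ τ) := by
  induction T with
  | leaf u => rfl
  | chance n p next ih => simp [Tree.nextVal, Tree.value, ih]
  | decision k next ih => cases k <;> simp [Tree.nextVal, Tree.value, ih]

/-! ### Weighted sums over information sets -/

/-- Bridges sums over all of `A` and facts known for legal actions only: the other actions have
probability zero. -/
theorem mul_eq_zero_of_support {p : PMF A} {S : Finset A} (hp : ∀ a ∈ p.support, a ∈ S) {a : A}
    {x : ℝ} (hx : a ∈ S → x = 0) : (p a).toReal * x = 0 := by
  by_cases ha : a ∈ S
  · rw [hx ha, mul_zero]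
  · rw [(PMF.apply_eq_zero_iff p a).2 fun h => ha (hp a h), ENNReal.toReal_zero, zero_mul]

section NodeSum

variable [Fintype A] [DecidableEq I₁] {L : I₁ → Finset A} {σ : I₀ → PMF A} {h : I₁}

/-- Linearity in one general form; scalar multiples and differences below are the cases of the index
types `Unit` and `Bool`. -/
theorem Tree.nodeSum_sum {ι : Type*} (S : Finset ι) (c : ι → ℝ)
    (F : ι → (A → Tree I₀ I₁ A) → ℝ) (T : Tree I₀ I₁ A) :
    T.nodeSum L σ h (fun next => ∑ b ∈ S, c b * F b next)
      = ∑ b ∈ S, c b * T.nodeSum L σ h (F b) := by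
  induction T with
  | leaf u => simp [Tree.nodeSum]
  | chance n p next ih =>
    simp only [Tree.nodeSum, ih, Finset.mul_sum]
    rw [Finset.sum_comm]
    exact Finset.sum_congr rfl fun _ _ => Finset.sum_congr rfl fun _ _ => by ring
  | decision k next ih =>
    cases k with
    | inl k =>
      simp only [Tree.nodeSum, ih, Finset.mul_sum]
      rw [Finset.sum_comm]
      exact Finset.sum_congr rfl fun _ _ => Finset.sum_congr rfl fun _ _ => by ring
    | inr k =>
      simp only [Tree.nodeSum]
      split_ifs with hk
      · rfl
      · simp only [ih, Finset.mul_sum]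
        rw [Finset.sum_comm]

theorem Tree.nodeSum_mul (c : ℝ) (F : (A → Tree I₀ I₁ A) → ℝ) (T : Tree I₀ I₁ A) :
    T.nodeSum L σ h (fun next => c * F next) = c * T.nodeSum L σ h F := by
  simpa using Tree.nodeSum_sum (L := L) (σ := σ) (h := h) ({()} : Finset Unit)
    (fun _ => c) (fun _ => F) T

theorem Tree.nodeSum_neg (F : (A → Tree I₀ I₁ A) → ℝ) (T : Tree I₀ I₁ A) :
    T.nodeSum L σ h (fun next => -F next) = -T.nodeSum L σ h F := by
  simpa using Tree.nodeSum_mul (L := L) (σ := σ) (h := h) (-1) F T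

theorem Tree.nodeSum_const (c : ℝ) (T : Tree I₀ I₁ A) :
    T.nodeSum L σ h (fun _ => c) = c * T.nodeSum L σ h fun _ => 1 := by
  simpa using Tree.nodeSum_mul (L := L) (σ := σ) (h := h) c (fun _ => 1) T

theorem Tree.nodeSum_sub (F F' : (A → Tree I₀ I₁ A) → ℝ) (T : Tree I₀ I₁ A) :
    T.nodeSum L σ h (fun next => F next - F' next)
      = T.nodeSum L σ h F - T.nodeSum L σ h F' := by
  have := Tree.nodeSum_sum (L := L) (σ := σ) (h := h) (Finset.univ : Finset Bool)
    (fun b => cond b 1 (-1)) (fun b => cond b F F') T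
  simpa [sub_eq_add_neg] using this

theorem Tree.nodeSum_mono {F F' : (A → Tree I₀ I₁ A) → ℝ} (hF : ∀ next, F next ≤ F' next)
    (T : Tree I₀ I₁ A) : T.nodeSum L σ h F ≤ T.nodeSum L σ h F' := by
  induction T with
  | leaf u => simp [Tree.nodeSum]
  | chance n p next ih =>
    simp only [Tree.nodeSum]
    exact Finset.sum_le_sum fun i _ => mul_le_mul_of_nonneg_left (ih i) ENNReal.toReal_nonneg
  | decision k next ih =>
    cases k with
    | inl k =>
      simp only [Tree.nodeSum]
      exact Finset.sum_le_sum fun i _ => mul_le_mul_of_nonneg_left (ih i) ENNReal.toReal_nonneg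
    | inr k =>
      simp only [Tree.nodeSum]
      split_ifs with hk
      · exact hF next
      · exact Finset.sum_le_sum fun i _ => ih i

theorem Tree.nodeSum_nonneg {F : (A → Tree I₀ I₁ A) → ℝ} (hF : ∀ next, 0 ≤ F next)
    (T : Tree I₀ I₁ A) : 0 ≤ T.nodeSum L σ h F := by
  have := Tree.nodeSum_mono (L := L) (σ := σ) (h := h) (F := fun _ => 0) hF T
  rwa [Tree.nodeSum_const, zero_mul] at this

/-- The node weights are nonnegative, so a vanishing total makes each of them vanish. This renders
division by a zero `reachWeight` harmless. -/
theorem Tree.nodeSum_eq_zero (F : (A → Tree I₀ I₁ A) → ℝ) (T : Tree I₀ I₁ A)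
    (hT : T.nodeSum L σ h (fun _ => 1) = 0) : T.nodeSum L σ h F = 0 := by
  induction T with
  | leaf u => simp [Tree.nodeSum]
  | chance n p next ih =>
    simp only [Tree.nodeSum] at hT ⊢
    rw [Finset.sum_eq_zero_iff_of_nonneg fun i _ =>
      mul_nonneg ENNReal.toReal_nonneg (Tree.nodeSum_nonneg (fun _ => zero_le_one) _)] at hT
    refine Finset.sum_eq_zero fun i hi => ?_
    rcases mul_eq_zero.1 (hT i hi) with h0 | h0
    · rw [h0, zero_mul]
    · rw [ih i h0, mul_zero]
  | decision k next ih =>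
    cases k with
    | inl k =>
      simp only [Tree.nodeSum] at hT ⊢
      rw [Finset.sum_eq_zero_iff_of_nonneg fun i _ =>
        mul_nonneg ENNReal.toReal_nonneg (Tree.nodeSum_nonneg (fun _ => zero_le_one) _)] at hT
      refine Finset.sum_eq_zero fun i hi => ?_
      rcases mul_eq_zero.1 (hT i hi) with h0 | h0
      · rw [h0, zero_mul]
      · rw [ih i h0, mul_zero]
    | inr k =>
      simp only [Tree.nodeSum] at hT ⊢
      split_ifs at hT ⊢ with hk
      · exact absurd hT one_ne_zero
      · rw [Finset.sum_eq_zero_iff_of_nonneg fun i _ =>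
          Tree.nodeSum_nonneg (fun _ => zero_le_one) _] at hT
        exact Finset.sum_eq_zero fun i hi => ih i (hT i hi)

variable {G : Game I₀ I₁ A} {seq : I₁ → List (I₁ × A)}

/-- Own histories only grow along a path, so a subtree with own history `pre` contains `h` only if
`pre` is a prefix of `seq h`. -/
theorem Tree.Recalls.nodeSum_eq_zero (hσ : Respects (fun k => G.legal (.inl k)) σ)
    (F : (A → Tree I₀ I₁ A) → ℝ) {T : Tree I₀ I₁ A} {pre : List (I₁ × A)}
    (hT : T.Recalls G seq pre) (hpre : ¬ pre <+: seq h) : T.nodeSum G.legal₁ σ h F = 0 := by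
  induction T generalizing pre with
  | leaf u => rfl
  | chance n p next ih =>
    simp only [Tree.nodeSum]
    exact Finset.sum_eq_zero fun i _ => by rw [ih i (hT i) hpre, mul_zero]
  | decision k next ih =>
    cases k with
    | inl k =>
      simp only [Tree.nodeSum]
      exact Finset.sum_eq_zero fun a _ =>
        mul_eq_zero_of_support (hσ k) fun ha => ih a (hT a ha) hpre
    | inr k =>
      simp only [Tree.nodeSum]
      rw [if_neg]
      · exact Finset.sum_eq_zero fun a ha => ih a (hT.2 a ha) fun h' =>
          hpre ((List.prefix_append _ _).trans h')
      · rintro rfl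
        exact hpre (hT.1 ▸ List.prefix_rfl)

/-- All moves of the list are legal. -/
def LegalMoves (G : Game I₀ I₁ A) (l : List (I₁ × A)) : Prop := ∀ x ∈ l, x.2 ∈ G.legal₁ x.1

/-- A nonzero sum exhibits a node of `h` behind legal moves, and `seq h` is its own history. -/
theorem Tree.Recalls.legalMoves (hσ : Respects (fun k => G.legal (.inl k)) σ)
    (F : (A → Tree I₀ I₁ A) → ℝ) {T : Tree I₀ I₁ A} {pre : List (I₁ × A)}
    (hT : T.Recalls G seq pre) (hpre : LegalMoves G pre) (h0 : T.nodeSum G.legal₁ σ h F ≠ 0) :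
    LegalMoves G (seq h) := by
  induction T generalizing pre with
  | leaf u => exact absurd rfl h0
  | chance n p next ih =>
    simp only [Tree.nodeSum] at h0
    obtain ⟨i, -, hi⟩ := Finset.exists_ne_zero_of_sum_ne_zero h0
    exact ih i (hT i) hpre (right_ne_zero_of_mul hi)
  | decision k next ih =>
    cases k with
    | inl k =>
      simp only [Tree.nodeSum] at h0
      obtain ⟨a, -, ha⟩ := Finset.exists_ne_zero_of_sum_ne_zero h0
      by_contra hc
      exact ha (mul_eq_zero_of_support (hσ k) fun hl => by_contra fun h1 => hc
        (ih a (hT a hl) hpre h1))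
    | inr k =>
      simp only [Tree.nodeSum] at h0
      split_ifs at h0 with hk
      · subst hk; rwa [hT.1]
      · obtain ⟨a, ha, ha0⟩ := Finset.exists_ne_zero_of_sum_ne_zero h0
        refine ih a (hT.2 a ha) ?_ ha0
        intro x hx
        rcases List.mem_append.1 hx with hx | hx
        · exact hpre x hx
        · rw [List.mem_singleton.1 hx]; exact ha

variable [Fintype I₁] [DecidableEq A]

/-- The first own information sets met below `pre` are those with history exactly `pre`, and no own
move precedes them in the subtree. What remains for `F = 0` is the payoff of plays that end before
any of them. -/
theorem Tree.Recalls.nextVal_eq (hσ : Respects (fun k => G.legal (.inl k)) σ)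
    (F : I₁ → (A → Tree I₀ I₁ A) → ℝ) {T : Tree I₀ I₁ A} {pre : List (I₁ × A)}
    (hT : T.Recalls G seq pre) :
    T.nextVal σ F = T.nextVal σ (fun _ _ => 0)
      + ∑ k, if seq k = pre then T.nodeSum G.legal₁ σ k (F k) else 0 := by
  induction T generalizing pre with
  | leaf u => simp [Tree.nextVal, Tree.nodeSum]
  | chance n p next ih =>
    simp only [Tree.nextVal, Tree.nodeSum]
    simp_rw [fun i => ih i (hT i), mul_add, Finset.sum_add_distrib, Finset.mul_sum]
    rw [Finset.sum_comm]
    congr 1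
    refine Finset.sum_congr rfl fun k _ => ?_
    split_ifs <;> simp
  | decision k next ih =>
    cases k with
    | inl k =>
      simp only [Tree.nextVal, Tree.nodeSum]
      have : ∀ a, (σ k a).toReal * (next a).nextVal σ F
          = (σ k a).toReal * (next a).nextVal σ (fun _ _ => 0)
            + ∑ k', if seq k' = pre then (σ k a).toReal * (next a).nodeSum G.legal₁ σ k' (F k')
              else 0 := by
        intro a
        by_cases ha : a ∈ G.legal (.inl k)
        · rw [ih a (hT a ha), mul_add, Finset.mul_sum]
          congr 1
          refine Finset.sum_congr rfl fun k _ => ?_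
          split_ifs <;> simp
        · rw [(PMF.apply_eq_zero_iff _ a).2 fun h => ha (hσ k a h)]
          simp
      simp_rw [this, Finset.sum_add_distrib]
      rw [Finset.sum_comm]
      congr 1
      refine Finset.sum_congr rfl fun k _ => ?_
      split_ifs <;> simp
    | inr k =>
      simp only [Tree.nextVal, zero_add, Tree.nodeSum]
      rw [Finset.sum_eq_single k]
      · simp [hT.1]
      · intro k' _ hk'
        rw [if_neg hk'.symm]
        split_ifs with hs
        · refine Finset.sum_eq_zero fun a ha => (hT.2 a ha).nodeSum_eq_zero hσ _ fun hp => ?_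
          have := hp.length_le
          simp [hs] at this
        · rfl
      · simp

/-- The Markov property supplied by perfect recall: every node of an information set `k` with
history `seq h ++ [(h, a)]` lies behind a node of `h` and the move `a`, so summing over the nodes of
`h` collects all of `k`. The condition on `pre` says that the move `a` at `h` has not yet been made.
-/
theorem Tree.Recalls.nodeSum_nextVal (hσ : Respects (fun k => G.legal (.inl k)) σ)
    (F : I₁ → (A → Tree I₀ I₁ A) → ℝ) {a : A} (ha : a ∈ G.legal₁ h) {T : Tree I₀ I₁ A}
    {pre : List (I₁ × A)} (hT : T.Recalls G seq pre) (hpre : ¬ seq h ++ [(h, a)] <+: pre) :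
    T.nodeSum G.legal₁ σ h (fun next => (next a).nextVal σ F)
      = T.nodeSum G.legal₁ σ h (fun next => (next a).nextVal σ fun _ _ => 0)
        + ∑ k, if seq k = seq h ++ [(h, a)] then T.nodeSum G.legal₁ σ k (F k) else 0 := by
  induction T generalizing pre with
  | leaf u => simp [Tree.nodeSum]
  | chance n p next ih =>
    simp only [Tree.nodeSum]
    simp_rw [fun i => ih i (hT i) hpre, mul_add, Finset.sum_add_distrib, Finset.mul_sum]
    rw [Finset.sum_comm]
    congr 1
    refine Finset.sum_congr rfl fun k _ => ?_
    split_ifs <;> simp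
  | decision k next ih =>
    cases k with
    | inl k =>
      simp only [Tree.nodeSum]
      have : ∀ b, (σ k b).toReal
            * (next b).nodeSum G.legal₁ σ h (fun next => (next a).nextVal σ F)
          = (σ k b).toReal
              * (next b).nodeSum G.legal₁ σ h (fun next => (next a).nextVal σ fun _ _ => 0)
            + ∑ k', if seq k' = seq h ++ [(h, a)] then
                (σ k b).toReal * (next b).nodeSum G.legal₁ σ k' (F k') else 0 := by
        intro b
        by_cases hb : b ∈ G.legal (.inl k)
        · rw [ih b (hT b hb) hpre, mul_add, Finset.mul_sum]
          congr 1
          refine Finset.sum_congr rfl fun k _ => ?_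
          split_ifs <;> simp
        · rw [(PMF.apply_eq_zero_iff _ b).2 fun h => hb (hσ k b h)]
          simp
      simp_rw [this, Finset.sum_add_distrib]
      rw [Finset.sum_comm]
      congr 1
      refine Finset.sum_congr rfl fun k _ => ?_
      split_ifs <;> simp
    | inr k =>
      simp only [Tree.nodeSum]
      by_cases hk : k = h
      · subst hk
        simp only [if_true]
        rw [(hT.2 a ha).nextVal_eq hσ F]
        congr 1
        refine Finset.sum_congr rfl fun k' _ => ?_
        rw [hT.1]
        -- The case `k' = k` is impossible by length. For `k' ≠ k` only the branch `a` contributes,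
        -- since any other branch starts a different history of the same length.
        split_ifs with hs hkk
        · subst hkk
          rw [hT.1] at hs
          simp at hs
        · symm
          refine Finset.sum_eq_single_of_mem a ha fun b hb hba => ?_
          refine (hT.2 b hb).nodeSum_eq_zero hσ _ fun hp => hba ?_
          have := List.IsPrefix.eq_of_length hp (by simp [hs])
          simpa [hs] using this
        · rfl
      · simp only [if_neg hk]
        have : ∀ b ∈ G.legal₁ k, ¬ seq h ++ [(h, a)] <+: pre ++ [(k, b)] := by
          intro b _ hp
          rcases List.prefix_concat_iff.1 hp with h1 | h1
          · have := List.append_inj_right' h1 rfl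
            simp at this
            exact hk this.1.symm
          · exact hpre h1
        rw [Finset.sum_congr rfl fun b hb => ih b (hT.2 b hb) (this b hb),
          Finset.sum_add_distrib, Finset.sum_comm]
        congr 1
        refine Finset.sum_congr rfl fun k' _ => ?_
        by_cases hs : seq k' = seq h ++ [(h, a)]
        · simp only [if_pos hs]
          -- If `k'` were the present node `k`, its history `pre` would already contain the move
          -- `(h, a)`.
          rw [if_neg]
          rintro rfl
          exact hpre (by rw [← hs, hT.1])
        · simp [hs]

end NodeSum

/-! ### Averages -/

section Average

variable [Fintype A]

theorem sum_toReal_eq_one (p : PMF A) : ∑ a, (p a).toReal = 1 := by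
  have := p.tsum_coe
  rw [tsum_fintype] at this
  rw [← ENNReal.toReal_sum fun a _ => p.apply_ne_top a, this, ENNReal.toReal_one]

theorem sum_toReal_mul_le {p : PMF A} {S : Finset A} (hp : ∀ a ∈ p.support, a ∈ S) {f : A → ℝ}
    {c : ℝ} (hf : ∀ a ∈ S, f a ≤ c) : ∑ a, (p a).toReal * f a ≤ c := by
  have : ∑ a, (p a).toReal * f a ≤ ∑ a, (p a).toReal * c := by
    refine Finset.sum_le_sum fun a _ => ?_
    have := mul_eq_zero_of_support hp (a := a) (x := (max (f a - c) 0)) fun ha =>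
      max_eq_right (sub_nonpos.2 (hf a ha))
    have h2 := mul_le_mul_of_nonneg_left (le_max_left (f a - c) 0)
      (ENNReal.toReal_nonneg (a := p a))
    linarith
  rwa [← Finset.sum_mul, sum_toReal_eq_one, one_mul] at this

theorem sum_toReal_mul_congr {p : PMF A} {S : Finset A} (hp : ∀ a ∈ p.support, a ∈ S)
    {f f' : A → ℝ} (hf : ∀ a ∈ S, f a = f' a) :
    ∑ a, (p a).toReal * f a = ∑ a, (p a).toReal * f' a := by
  refine Finset.sum_congr rfl fun a _ => ?_
  have := mul_eq_zero_of_support hp (a := a) (x := f a - f' a) fun ha => sub_eq_zero.2 (hf a ha)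
  linarith

theorem sum_toReal_mul_eq_const {p : PMF A} {f : A → ℝ} {c : ℝ} (hf : ∀ a ∈ p.support, f a = c) :
    ∑ a, (p a).toReal * f a = c := by
  classical
  rw [sum_toReal_mul_congr (S := p.support.toFinset) (fun a ha => by simpa using ha)
    (f' := fun _ => c) fun a ha => hf a (by simpa using ha), ← Finset.sum_mul,
    sum_toReal_eq_one, one_mul]

/-- An average that attains an upper bound of its terms attains it at every term of positive weight.
-/
theorem eq_of_sum_toReal_mul_eq {p : PMF A} {S : Finset A} (hp : ∀ a ∈ p.support, a ∈ S)
    {f : A → ℝ} {c : ℝ} (hf : ∀ a ∈ S, f a ≤ c) (hc : ∑ a, (p a).toReal * f a = c) {a : A}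
    (ha : a ∈ p.support) : f a = c := by
  have h0 : ∀ b ∈ Finset.univ, 0 ≤ (p b).toReal * (c - f b) := by
    intro b _
    by_cases hb : b ∈ S
    · exact mul_nonneg ENNReal.toReal_nonneg (sub_nonneg.2 (hf b hb))
    · rw [(PMF.apply_eq_zero_iff p b).2 fun h => hb (hp b h), ENNReal.toReal_zero, zero_mul]
  have h1 : ∑ b, (p b).toReal * (c - f b) = 0 := by
    simp_rw [mul_sub, Finset.sum_sub_distrib]
    rw [hc, ← Finset.sum_mul, sum_toReal_eq_one, one_mul, sub_self]
  rcases mul_eq_zero.1 ((Finset.sum_eq_zero_iff_of_nonneg h0).1 h1 a (Finset.mem_univ a)) with h | h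
  · exact absurd ((ENNReal.toReal_eq_zero_iff _).1 h)
      (not_or.2 ⟨(PMF.mem_support_iff p a).1 ha, p.apply_ne_top a⟩)
  · linarith

end Average

/-! ### Largest action values -/

section MaxVal

/-- The largest value of a legal action at `h`. -/
def Game.maxVal (G : Game I₀ I₁ A) (q : I₁ → A → ℝ) (h : I₁) : ℝ :=
  (G.legal₁ h).sup' (G.legal_nonempty (.inr h)) (q h)

variable {G : Game I₀ I₁ A} {h : I₁}

theorem Game.le_maxVal {q : I₁ → A → ℝ} {a : A} (ha : a ∈ G.legal₁ h) : q h a ≤ G.maxVal q h :=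
  Finset.le_sup' (q h) ha

theorem Game.exists_eq_maxVal (G : Game I₀ I₁ A) (q : I₁ → A → ℝ) (h : I₁) :
    ∃ a ∈ G.legal₁ h, G.maxVal q h = q h a :=
  Finset.exists_mem_eq_sup' (G.legal_nonempty (.inr h)) (q h)

theorem Game.maxVal_le {q : I₁ → A → ℝ} {c : ℝ} (hq : ∀ a ∈ G.legal₁ h, q h a ≤ c) :
    G.maxVal q h ≤ c :=
  Finset.sup'_le _ _ hq

theorem Game.maxVal_congr {q q' : I₁ → A → ℝ} (hq : ∀ a ∈ G.legal₁ h, q h a = q' h a) :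
    G.maxVal q h = G.maxVal q' h :=
  Finset.sup'_congr _ rfl hq

theorem Game.abs_maxVal_sub_le {q q' : I₁ → A → ℝ} {δ : ℝ}
    (hq : ∀ a ∈ G.legal₁ h, |q h a - q' h a| ≤ δ) : |G.maxVal q h - G.maxVal q' h| ≤ δ := by
  rw [abs_sub_le_iff]
  constructor
  · have : G.maxVal q h ≤ G.maxVal q' h + δ := Game.maxVal_le fun a ha => by
      have := (abs_sub_le_iff.1 (hq a ha)).1
      have := Game.le_maxVal (q := q') ha
      linarith
    linarith
  · have : G.maxVal q' h ≤ G.maxVal q h + δ := Game.maxVal_le fun a ha => by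
      have := (abs_sub_le_iff.1 (hq a ha)).2
      have := Game.le_maxVal (q := q) ha
      linarith
    linarith

theorem Game.tendsto_maxVal {ι : Type*} {l : Filter ι} {q : ι → I₁ → A → ℝ} {q' : I₁ → A → ℝ}
    (hq : ∀ a ∈ G.legal₁ h, Tendsto (fun t => q t h a) l (𝓝 (q' h a))) :
    Tendsto (fun t => G.maxVal (q t) h) l (𝓝 (G.maxVal q' h)) :=
  Tendsto.finset_sup'_nhds_apply (G.legal_nonempty (.inr h)) hq

end MaxVal

/-! ### The Bellman operator of the opponent -/

/-- Backward induction. `I₁` is finite, so history lengths are bounded, and the induction runs on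
the distance to the maximal length; at maximal length the premise is vacuous. -/
theorem forall_of_forall_next [Fintype I₁] {seq : I₁ → List (I₁ × A)} {P : I₁ → Prop}
    (H : ∀ h, (∀ k, (seq k).length = (seq h).length + 1 → P k) → P h) (h : I₁) : P h := by
  suffices ∀ n h, Finset.univ.sup (fun k => (seq k).length) - (seq h).length = n → P h from
    this _ h rfl
  intro n
  induction n with
  | zero =>
    intro h hn
    refine H h fun k hk => ?_
    have := Finset.le_sup (f := fun k => (seq k).length) (Finset.mem_univ k)
    omega
  | succ n ih => exact fun h hn => H h fun k hk => ih k (by omega)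

section Bellman

variable [Fintype A] [DecidableEq I₁]

/-- Conditional expected value of player 1, given that `h` has been reached and `a` is played there,
if its next information set `k` is worth `V k`. -/
def Game.bellman (G : Game I₀ I₁ A) (σ : I₀ → PMF A) (V : I₁ → ℝ) (h : I₁) (a : A) : ℝ :=
  G.root.nodeSum G.legal₁ σ h (fun next => (next a).nextVal σ fun k _ => V k) / G.reachWeight σ h

/-- `V` solves the optimality equation of player 1 against `σ`. -/
def Game.IsOptimal (G : Game I₀ I₁ A) (σ : I₀ → PMF A) (V : I₁ → ℝ) : Prop :=
  ∀ h, G.Reachable₁ σ h → V h = G.maxVal (G.bellman σ V) h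

variable {G : Game I₀ I₁ A} {σ : I₀ → PMF A} {h : I₁}

theorem Game.isGreedyStrategy_congr {q q' : I₁ → A → ℝ}
    (hq : ∀ h, G.Reachable₁ σ h → ∀ a ∈ G.legal₁ h, q h a = q' h a) {τ : I₁ → PMF A}
    (hτ : G.IsGreedyStrategy σ q τ) : G.IsGreedyStrategy σ q' τ :=
  ⟨hτ.1, fun h hh a ha b hb => by
    rw [← hq h hh a (hτ.1 h a ha), ← hq h hh b hb]
    exact hτ.2 h hh a ha b hb⟩

theorem Game.exists_isGreedyStrategy (G : Game I₀ I₁ A) (σ : I₀ → PMF A)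
    (q : I₁ → A → ℝ) : ∃ τ, G.IsGreedyStrategy σ q τ := by
  choose t ht ht' using G.exists_eq_maxVal q
  refine ⟨pureStrategy t, ?_, ?_⟩
  · intro h a ha
    simp only [pureStrategy, PMF.support_pure, Set.mem_singleton_iff] at ha
    exact ha ▸ ht h
  · intro h _ a ha b hb
    simp only [pureStrategy, PMF.support_pure, Set.mem_singleton_iff] at ha
    rw [ha, ← ht']
    exact Game.le_maxVal hb

theorem Game.reachWeight_nonneg (G : Game I₀ I₁ A) (σ : I₀ → PMF A) (h : I₁) :
    0 ≤ G.reachWeight σ h :=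
  Tree.nodeSum_nonneg (fun _ => zero_le_one) _

theorem Game.reachWeight_eq_zero (hh : ¬ G.Reachable₁ σ h) : G.reachWeight σ h = 0 :=
  le_antisymm (not_lt.1 hh) (G.reachWeight_nonneg σ h)

/-- Clears the denominator in `actionValue`; where the reach weight is zero, both sides vanish. -/
theorem Game.reachWeight_mul_infoValue (τ : I₁ → PMF A) :
    G.reachWeight σ h * G.infoValue σ τ h = G.root.nodeSum G.legal₁ σ h
      fun next => -∑ a, (τ h a).toReal * (next a).value (Sum.elim σ τ) := by
  rw [Tree.nodeSum_neg, Tree.nodeSum_sum, Game.infoValue, Finset.mul_sum, ← Finset.sum_neg_distrib]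
  refine Finset.sum_congr rfl fun a _ => ?_
  rw [Game.actionValue]
  by_cases h0 : G.reachWeight σ h = 0
  · rw [h0, Tree.nodeSum_eq_zero _ _ h0]; simp
  · field_simp

variable [Fintype I₁] [DecidableEq A] {seq : I₁ → List (I₁ × A)}

variable (hG : G.root.Recalls G seq []) (hσ : Respects (fun k => G.legal (.inl k)) σ)
include hG hσ

theorem Game.nodeSum_nextVal (F : I₁ → (A → Tree I₀ I₁ A) → ℝ) {a : A} (ha : a ∈ G.legal₁ h) :
    G.root.nodeSum G.legal₁ σ h (fun next => (next a).nextVal σ F)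
      = G.root.nodeSum G.legal₁ σ h (fun next => (next a).nextVal σ fun _ _ => 0)
        + ∑ k, if seq k = seq h ++ [(h, a)] then G.root.nodeSum G.legal₁ σ k (F k) else 0 :=
  hG.nodeSum_nextVal hσ F ha (by simp)

/-- The decision-process form: an immediate payoff plus transitions to the successors `k` of `(h,
a)`, with weights free of player 1's strategy. -/
theorem Game.bellman_eq (V : I₁ → ℝ) {a : A} (ha : a ∈ G.legal₁ h) :
    G.bellman σ V h a
      = (G.root.nodeSum G.legal₁ σ h (fun next => (next a).nextVal σ fun _ _ => 0)
        + ∑ k, if seq k = seq h ++ [(h, a)] then V k * G.reachWeight σ k else 0)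
          / G.reachWeight σ h := by
  rw [Game.bellman, Game.nodeSum_nextVal hG hσ _ ha]
  simp_rw [fun k => Tree.nodeSum_const (L := G.legal₁) (σ := σ) (h := k) (V k) G.root,
    Game.reachWeight]

/-- Policy evaluation. Reachability is not needed, since both sides have the same denominator. -/
theorem Game.actionValue_eq_bellman (τ : I₁ → PMF A) {a : A} (ha : a ∈ G.legal₁ h) :
    G.actionValue σ τ h a = G.bellman σ (G.infoValue σ τ) h a := by
  rw [Game.bellman_eq hG hσ _ ha, Game.actionValue, ← Tree.nodeSum_neg]
  simp_rw [← Tree.nextVal_value]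
  rw [Game.nodeSum_nextVal hG hσ _ ha]
  simp_rw [← Game.reachWeight_mul_infoValue, mul_comm]

theorem Game.payoff₁_eq (τ : I₁ → PMF A) :
    G.payoff₁ σ τ = G.root.nextVal σ (fun _ _ => 0)
      + ∑ k, if seq k = [] then G.reachWeight σ k * G.infoValue σ τ k else 0 := by
  rw [Game.payoff₁, ← Tree.nextVal_value, hG.nextVal_eq hσ]
  simp_rw [← Game.reachWeight_mul_infoValue]

/-- After division by `reachWeight σ h` the left side is the probability of meeting another own
information set after `(h, a)`; the missing mass belongs to plays that end first. -/
theorem Game.sum_reachWeight_le {a : A} (ha : a ∈ G.legal₁ h) :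
    ∑ k, (if seq k = seq h ++ [(h, a)] then G.reachWeight σ k else 0) ≤ G.reachWeight σ h := by
  have key := Game.nodeSum_nextVal (h := h) hG hσ (fun _ _ => 1) ha
  -- Paying one unit at the next own information set instead of nothing adds exactly the probability
  -- of getting there.
  have hle : ∀ T : Tree I₀ I₁ A,
      T.nextVal σ (fun _ _ => 1) - T.nextVal σ (fun _ _ => 0) ≤ 1 := by
    intro T
    induction T with
    | leaf u => simp [Tree.nextVal]
    | chance n p next ih =>
      simp only [Tree.nextVal, ← Finset.sum_sub_distrib, ← mul_sub]
      exact sum_toReal_mul_le (S := Finset.univ) (fun _ _ => Finset.mem_univ _) fun i _ => ih i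
    | decision k next ih =>
      cases k with
      | inl k =>
        simp only [Tree.nextVal, ← Finset.sum_sub_distrib, ← mul_sub]
        exact sum_toReal_mul_le (S := Finset.univ) (fun _ _ => Finset.mem_univ _) fun i _ => ih i
      | inr k => simp [Tree.nextVal]
  have := Tree.nodeSum_mono (L := G.legal₁) (σ := σ) (h := h)
    (fun next => hle (next a)) G.root
  rw [Tree.nodeSum_sub] at this
  have h2 : ∀ k, G.root.nodeSum G.legal₁ σ k (fun _ => 1) = G.reachWeight σ k := fun _ => rfl
  simp_rw [h2] at key this
  linarith

theorem Game.bellman_mono {V V' : I₁ → ℝ} {a : A} (ha : a ∈ G.legal₁ h)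
    (hV : ∀ k, (seq k).length = (seq h).length + 1 → G.Reachable₁ σ k → V k ≤ V' k) :
    G.bellman σ V h a ≤ G.bellman σ V' h a := by
  rw [Game.bellman_eq hG hσ _ ha, Game.bellman_eq hG hσ _ ha]
  refine div_le_div_of_nonneg_right (add_le_add le_rfl (Finset.sum_le_sum fun k _ => ?_))
    (G.reachWeight_nonneg σ h)
  split_ifs with hk
  · by_cases hr : G.Reachable₁ σ k
    · exact mul_le_mul_of_nonneg_right (hV k (by simp [hk]) hr) (G.reachWeight_nonneg σ k)
    · simp [Game.reachWeight_eq_zero hr]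
  · exact le_rfl

theorem Game.bellman_congr {V V' : I₁ → ℝ} {a : A} (ha : a ∈ G.legal₁ h)
    (hV : ∀ k, (seq k).length = (seq h).length + 1 → G.Reachable₁ σ k → V k = V' k) :
    G.bellman σ V h a = G.bellman σ V' h a :=
  le_antisymm (Game.bellman_mono hG hσ ha fun k hk hr => (hV k hk hr).le)
    (Game.bellman_mono hG hσ ha fun k hk hr => (hV k hk hr).ge)

theorem Game.tendsto_bellman {ι : Type*} {l : Filter ι} {V : ι → I₁ → ℝ} {V' : I₁ → ℝ} {a : A}
    (ha : a ∈ G.legal₁ h)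
    (hV : ∀ k, (seq k).length = (seq h).length + 1 → G.Reachable₁ σ k →
      Tendsto (fun t => V t k) l (𝓝 (V' k))) :
    Tendsto (fun t => G.bellman σ (V t) h a) l (𝓝 (G.bellman σ V' h a)) := by
  simp_rw [Game.bellman_eq hG hσ _ ha]
  refine (tendsto_const_nhds.add (tendsto_finsetSum _ fun k _ => ?_)).div_const _
  split_ifs with hk
  · by_cases hr : G.Reachable₁ σ k
    · exact (hV k (by simp [hk]) hr).mul_const _
    · simpa [Game.reachWeight_eq_zero hr] using tendsto_const_nhds
  · exact tendsto_const_nhds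

/-- Only nonexpansive, with constant one: transition weights sum to at most one and there is no
discount. -/
theorem Game.abs_bellman_sub_le {V V' : I₁ → ℝ} {a : A} {δ : ℝ} (hδ : 0 ≤ δ)
    (ha : a ∈ G.legal₁ h) (hh : G.Reachable₁ σ h)
    (hV : ∀ k, G.Reachable₁ σ k → |V k - V' k| ≤ δ) :
    |G.bellman σ V h a - G.bellman σ V' h a| ≤ δ := by
  rw [Game.bellman_eq hG hσ _ ha, Game.bellman_eq hG hσ _ ha, ← sub_div, add_sub_add_left_eq_sub,
    ← Finset.sum_sub_distrib, abs_div, abs_of_pos (show 0 < G.reachWeight σ h from hh),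
    div_le_iff₀ hh]
  refine (Finset.abs_sum_le_sum_abs _ _).trans (le_trans ?_
    (mul_le_mul_of_nonneg_left (Game.sum_reachWeight_le hG hσ ha) hδ))
  rw [Finset.mul_sum]
  refine Finset.sum_le_sum fun k _ => ?_
  split_ifs with hk
  · by_cases hr : G.Reachable₁ σ k
    · rw [← sub_mul, abs_mul, abs_of_nonneg (G.reachWeight_nonneg σ k)]
      exact mul_le_mul_of_nonneg_right (hV k hr) (G.reachWeight_nonneg σ k)
    · simp [Game.reachWeight_eq_zero hr]
  · simp

/-- Value iteration from zero becomes stationary at each reachable information set once it has done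
so at all reachable ones one level deeper; finiteness gives a common stopping time. -/
theorem Game.exists_isOptimal : ∃ V, G.IsOptimal σ V := by
  set V : ℕ → I₁ → ℝ := fun n => (fun V => G.maxVal (G.bellman σ V))^[n] 0 with hVdef
  have hstep : ∀ n h, V (n + 1) h = G.maxVal (G.bellman σ (V n)) h := fun n h => by
    simp only [hVdef, Function.iterate_succ_apply']
  have hev : ∀ h, ∀ᶠ n in atTop, G.Reachable₁ σ h → V (n + 1) h = V n h := by
    refine forall_of_forall_next (seq := seq) fun h ih => ?_
    have h1 : ∀ᶠ n in atTop, ∀ k, (seq k).length = (seq h).length + 1 →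
        G.Reachable₁ σ k → V (n + 1) k = V n k := by
      rw [eventually_all]
      intro k
      by_cases hk : (seq k).length = (seq h).length + 1
      · filter_upwards [ih k hk] with n hn _ using hn
      · exact Eventually.of_forall fun n h' => absurd h' hk
    -- Iterate `n + 1` at `h` is computed from iterate `n` at its successors, so stationarity
    -- arrives one step later.
    rw [← map_add_atTop_eq_nat 1, eventually_map]
    filter_upwards [h1] with n hn _
    rw [hstep, hstep]
    exact Game.maxVal_congr fun a ha => Game.bellman_congr hG hσ ha hn
  obtain ⟨n, hn⟩ := (eventually_all.2 hev).exists
  exact ⟨V n, fun h hh => by rw [← hn h hh, hstep]⟩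

variable {V : I₁ → ℝ} (hV : G.IsOptimal σ V) {τ : I₁ → PMF A}
include hV

theorem Game.IsOptimal.infoValue_le (hτ : Respects G.legal₁ τ) (hh : G.Reachable₁ σ h) :
    G.infoValue σ τ h ≤ V h := by
  revert hh
  refine forall_of_forall_next (seq := seq)
    (P := fun h => G.Reachable₁ σ h → G.infoValue σ τ h ≤ V h) (fun h ih hh => ?_) h
  refine sum_toReal_mul_le (hτ h) fun a ha => ?_
  rw [Game.actionValue_eq_bellman hG hσ τ ha, hV h hh]
  exact (Game.bellman_mono hG hσ ha fun k hk hr => ih k hk hr).trans (Game.le_maxVal ha)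

theorem Game.IsOptimal.infoValue_eq (hτ : G.IsGreedyStrategy σ (G.bellman σ V) τ)
    (hh : G.Reachable₁ σ h) : G.infoValue σ τ h = V h := by
  revert hh
  refine forall_of_forall_next (seq := seq)
    (P := fun h => G.Reachable₁ σ h → G.infoValue σ τ h = V h) (fun h ih hh => ?_) h
  refine sum_toReal_mul_eq_const fun a ha => ?_
  have hl := hτ.1 h a ha
  rw [Game.actionValue_eq_bellman hG hσ τ hl, hV h hh,
    Game.bellman_congr hG hσ hl fun k hk hr => ih k hk hr]
  exact le_antisymm (Game.le_maxVal hl) (Game.maxVal_le fun b hb => hτ.2 h hh a ha b hb)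

/-- The total payoff is a constant plus the values of the first own information sets with
nonnegative weights, so optimality there gives optimality overall. -/
theorem Game.IsOptimal.isBestResponse (hτ : G.IsGreedyStrategy σ (G.bellman σ V) τ) :
    G.IsBestResponse σ τ where
  legal := hτ.1
  sequential h hh τ' hτ' := by
    rw [hV.infoValue_eq hG hσ hτ hh]
    exact hV.infoValue_le hG hσ hτ' hh
  overall τ' hτ' := by
    rw [Game.payoff₁_eq hG hσ, Game.payoff₁_eq hG hσ]
    refine add_le_add le_rfl (Finset.sum_le_sum fun k _ => ?_)
    split_ifs
    · by_cases hr : G.Reachable₁ σ k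
      · rw [hV.infoValue_eq hG hσ hτ hr]
        exact mul_le_mul_of_nonneg_left (hV.infoValue_le hG hσ hτ' hr) (G.reachWeight_nonneg σ k)
      · simp [Game.reachWeight_eq_zero hr]
    · exact le_rfl

/-- `V` bounds every information-set value and a greedy strategy attains it, so a best response must
attain it too. -/
theorem Game.IsBestResponse.infoValue_eq (hτ : G.IsBestResponse σ τ) (hh : G.Reachable₁ σ h) :
    G.infoValue σ τ h = V h := by
  obtain ⟨τ', hτ'⟩ := G.exists_isGreedyStrategy σ (G.bellman σ V)
  refine le_antisymm (hV.infoValue_le hG hσ hτ.legal hh) ?_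
  rw [← hV.infoValue_eq hG hσ hτ' hh]
  exact hτ.sequential h hh τ' hτ'.1

theorem Game.IsBestResponse.actionValue_eq (hτ : G.IsBestResponse σ τ) {a : A}
    (ha : a ∈ G.legal₁ h) : G.actionValue σ τ h a = G.bellman σ V h a := by
  rw [Game.actionValue_eq_bellman hG hσ τ ha]
  exact Game.bellman_congr hG hσ ha fun k _ hr => hτ.infoValue_eq hG hσ hV hr

/-- The mean of the action values under `τ h` equals their maximum `V h`, so every action that `τ`
uses is maximal. -/
theorem Game.IsBestResponse.isGreedyStrategy (hτ : G.IsBestResponse σ τ) :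
    G.IsGreedyStrategy σ (G.bellman σ V) τ := by
  refine ⟨hτ.legal, fun h hh a ha b hb => ?_⟩
  have h1 : ∀ a ∈ G.legal₁ h, G.actionValue σ τ h a ≤ V h := fun a ha => by
    rw [hτ.actionValue_eq hG hσ hV ha, hV h hh]
    exact Game.le_maxVal ha
  have h2 := eq_of_sum_toReal_mul_eq (hτ.legal h) h1 (hτ.infoValue_eq hG hσ hV hh) ha
  rw [← hτ.actionValue_eq hG hσ hV (hτ.legal h a ha), h2, hV h hh]
  exact Game.le_maxVal hb

theorem Game.isGreedyStrategy_iff_isBestResponse {τ' : I₁ → PMF A} (hτ : G.IsBestResponse σ τ) :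
    G.IsGreedyStrategy σ (G.actionValue σ τ) τ' ↔ G.IsBestResponse σ τ' :=
  ⟨fun h' => hV.isBestResponse hG hσ
    (Game.isGreedyStrategy_congr (fun _ _ _ ha => hτ.actionValue_eq hG hσ hV ha) h'),
  fun h' => Game.isGreedyStrategy_congr
    (fun _ _ _ ha => (hτ.actionValue_eq hG hσ hV ha).symm) (h'.isGreedyStrategy hG hσ hV)⟩

end Bellman

/-! ### Integration over episodes -/

section Episodes

theorem PMF.bind_congr_of_support {α β : Type*} {p : PMF α} {f f' : α → PMF β}
    (hf : ∀ a ∈ p.support, f a = f' a) : p.bind f = p.bind f' := by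
  ext b
  simp only [PMF.bind_apply]
  refine tsum_congr fun a => ?_
  by_cases ha : a ∈ p.support
  · rw [hf a ha]
  · rw [(PMF.apply_eq_zero_iff p a).2 ha, zero_mul, zero_mul]

theorem PMF.eq_pure_of_support {α : Type*} {p : PMF α} {a : α} (hp : ∀ b ∈ p.support, b = a) :
    p = PMF.pure a := by
  have hs : p.support = {a} := by
    refine Set.Subset.antisymm (fun b hb => hp b hb) ?_
    obtain ⟨b, hb⟩ := p.support_nonempty
    rintro _ rfl
    exact hp b hb ▸ hb
  ext b
  by_cases hb : b = a
  · subst hb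
    rw [PMF.pure_apply_self]
    exact (PMF.apply_eq_one_iff p b).2 hs
  · rw [PMF.pure_apply_of_ne _ _ hb, PMF.apply_eq_zero_iff, hs]
    exact hb

theorem PMF.ae_of_support {α : Type*} [MeasurableSpace α] [DiscreteMeasurableSpace α] {p : PMF α}
    {P : α → Prop} (hP : ∀ a ∈ p.support, P a) : ∀ᵐ a ∂p.toMeasure, P a := by
  rw [ae_iff, PMF.toMeasure_apply_eq_zero_iff p (MeasurableSet.of_discrete)]
  exact Set.disjoint_left.2 fun a ha h' => h' (hP a ha)

theorem PMF.toReal_toMeasure_pos_iff {α : Type*} [MeasurableSpace α] [DiscreteMeasurableSpace α]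
    {p : PMF α} {S : Set α} : 0 < (p.toMeasure S).toReal ↔ ∃ a ∈ p.support, a ∈ S := by
  rw [ENNReal.toReal_pos_iff, and_iff_left (measure_lt_top _ _), pos_iff_ne_zero, Ne,
    PMF.toMeasure_apply_eq_zero_iff p (MeasurableSet.of_discrete), Set.not_disjoint_iff]

/-- The empty episode. -/
def Episode.nil : Episode I₀ I₁ A := ([] : List _)

/-- Put an entry in front of an episode. -/
def Episode.cons (x : ℕ ⊕ ((I₀ ⊕ I₁) × A)) (e : Episode I₀ I₁ A) : Episode I₀ I₁ A :=
  List.cons x e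

theorem Tree.law_leaf (π : I₀ ⊕ I₁ → PMF A) (u : ℝ) :
    (Tree.leaf u).law π = PMF.pure Episode.nil := rfl

theorem Tree.law_chance (π : I₀ ⊕ I₁ → PMF A) (n : ℕ) (p : PMF (Fin n))
    (next : Fin n → Tree I₀ I₁ A) :
    (Tree.chance n p next).law π
      = p.bind fun i => ((next i).law π).map (Episode.cons (Sum.inl (i : ℕ))) := rfl

theorem Tree.law_decision (π : I₀ ⊕ I₁ → PMF A) (h : I₀ ⊕ I₁) (next : A → Tree I₀ I₁ A) :
    (Tree.decision h next).law π
      = (π h).bind fun a => ((next a).law π).map (Episode.cons (Sum.inr (h, a))) := rfl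

/-- Writes an episode law as a finite mixture over the first entry, which turns integrals over
episodes into recursions on the tree. -/
theorem PMF.toMeasure_bind_map {ι : Type*} [Fintype ι] (p : PMF ι)
    (q : ι → PMF (Episode I₀ I₁ A)) (f : ι → Episode I₀ I₁ A → Episode I₀ I₁ A) :
    (p.bind fun i => (q i).map (f i)).toMeasure
      = ∑ i, p i • (q i).toMeasure.map (f i) := by
  ext S hS
  rw [PMF.toMeasure_bind_apply _ _ _ hS, tsum_fintype, Measure.finsetSum_apply]
  refine Finset.sum_congr rfl fun i _ => ?_
  rw [Measure.smul_apply, PMF.toMeasure_map _ _ Measurable.of_discrete, smul_eq_mul]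

theorem Tree.integral_law_leaf {π : I₀ ⊕ I₁ → PMF A} (u : ℝ) (f : Episode I₀ I₁ A → ℝ) :
    ∫ e, f e ∂((Tree.leaf u).law π).toMeasure = f Episode.nil := by
  rw [Tree.law_leaf, PMF.toMeasure_pure, integral_dirac]

variable [Fintype A] {π : I₀ ⊕ I₁ → PMF A}

/-- Every function is integrable, without any bound: branching is finite, so the law is built from
Dirac measures by finite mixtures. -/
theorem Tree.integrable_law (T : Tree I₀ I₁ A) (f : Episode I₀ I₁ A → ℝ) :
    Integrable f (T.law π).toMeasure := by
  induction T generalizing f with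
  | leaf u =>
    rw [Tree.law_leaf, PMF.toMeasure_pure]
    exact integrable_dirac (by simp)
  | chance n p next ih =>
    rw [Tree.law_chance, PMF.toMeasure_bind_map]
    refine integrable_finsetSum_measure.2 fun i _ => Integrable.smul_measure ?_ (p.apply_ne_top i)
    rw [integrable_map_measure Measurable.of_discrete.aestronglyMeasurable
      Measurable.of_discrete.aemeasurable]
    exact ih i _
  | decision h next ih =>
    rw [Tree.law_decision, PMF.toMeasure_bind_map]
    refine integrable_finsetSum_measure.2 fun i _ => Integrable.smul_measure ?_
      ((π h).apply_ne_top i)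
    rw [integrable_map_measure Measurable.of_discrete.aestronglyMeasurable
      Measurable.of_discrete.aemeasurable]
    exact ih i _

theorem Tree.integral_law_chance (n : ℕ) (p : PMF (Fin n)) (next : Fin n → Tree I₀ I₁ A)
    (f : Episode I₀ I₁ A → ℝ) :
    ∫ e, f e ∂((Tree.chance n p next).law π).toMeasure
      = ∑ i, (p i).toReal * ∫ e, f (Episode.cons (Sum.inl (i : ℕ)) e) ∂((next i).law π).toMeasure := by
  have hI := Tree.integrable_law (π := π) (Tree.chance n p next) f
  rw [Tree.law_chance, PMF.toMeasure_bind_map] at hI ⊢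
  rw [integral_finsetSum_measure fun i hi => integrable_finsetSum_measure.1 hI i hi]
  refine Finset.sum_congr rfl fun i _ => ?_
  rw [integral_smul_measure, smul_eq_mul, integral_map Measurable.of_discrete.aemeasurable
    Measurable.of_discrete.aestronglyMeasurable]

theorem Tree.integral_law_decision (h : I₀ ⊕ I₁) (next : A → Tree I₀ I₁ A)
    (f : Episode I₀ I₁ A → ℝ) :
    ∫ e, f e ∂((Tree.decision h next).law π).toMeasure
      = ∑ a, (π h a).toReal *
        ∫ e, f (Episode.cons (Sum.inr (h, a)) e) ∂((next a).law π).toMeasure := by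
  have hI := Tree.integrable_law (π := π) (Tree.decision h next) f
  rw [Tree.law_decision, PMF.toMeasure_bind_map] at hI ⊢
  rw [integral_finsetSum_measure fun i hi => integrable_finsetSum_measure.1 hI i hi]
  refine Finset.sum_congr rfl fun i _ => ?_
  rw [integral_smul_measure, smul_eq_mul, integral_map Measurable.of_discrete.aemeasurable
    Measurable.of_discrete.aestronglyMeasurable]

/-- The bound covers records that are not plays of the tree, whose outcome may be the default `0`;
estimates that must hold on every sequence of records use this. -/
theorem Tree.exists_abs_outcome_le (T : Tree I₀ I₁ A) :
    ∃ C, ∀ e, |T.outcome e| ≤ C := by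
  induction T with
  | leaf u => exact ⟨|u|, fun e => le_rfl⟩
  | chance n p next ih =>
    choose C hC using ih
    have h0 : ∀ i, 0 ≤ C i := fun i => (abs_nonneg _).trans (hC i [])
    have hs : 0 ≤ ∑ i, C i := Finset.sum_nonneg fun i _ => h0 i
    refine ⟨∑ i, C i, fun e => ?_⟩
    match e with
    | [] => simpa [Tree.outcome] using hs
    | .inr _ :: _ => simpa [Tree.outcome] using hs
    | .inl i :: l =>
      simp only [Tree.outcome]
      split_ifs with hi
      · exact (hC _ l).trans (Finset.single_le_sum (fun i _ => h0 i) (Finset.mem_univ _))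
      · simpa using hs
  | decision k next ih =>
    choose C hC using ih
    have h0 : ∀ i, 0 ≤ C i := fun i => (abs_nonneg _).trans (hC i [])
    have hs : 0 ≤ ∑ i, C i := Finset.sum_nonneg fun i _ => h0 i
    refine ⟨∑ i, C i, fun e => ?_⟩
    match e with
    | [] => simpa [Tree.outcome] using hs
    | .inl _ :: _ => simpa [Tree.outcome] using hs
    | .inr (_, a) :: l =>
      simp only [Tree.outcome]
      exact (hC _ l).trans (Finset.single_le_sum (fun i _ => h0 i) (Finset.mem_univ _))

end Episodes

/-! ### The victim is forced -/

section Forced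

/-- At all information sets of the victim that occur when the victim plays `s`, the mask retains
only the action of `s`. -/
def Tree.Forced {G : Game I₀ I₁ A} (M : Mask G) (s : I₀ → A) : Tree I₀ I₁ A → Prop
  | .leaf _ => True
  | .chance _ p next => ∀ i ∈ p.support, (next i).Forced M s
  | .decision (.inl k) next => M.keep k = {s k} ∧ (next (s k)).Forced M s
  | .decision (.inr k) next => ∀ a ∈ G.legal₁ k, (next a).Forced M s

variable {G : Game I₀ I₁ A} {M : Mask G} {s : I₀ → A} {π : I₀ ⊕ I₁ → PMF A}

/-- Since `π` uses every available action, any episode of a subtree compatible with the mask extends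
to an episode of the whole tree, so the hypothesis descends. -/
theorem Tree.forced_of_support (hs : ∀ h, s h ∈ M.keep h)
    (hπ : ∀ h, ∀ a ∈ M.avail h, a ∈ (π h).support) (T : Tree I₀ I₁ A)
    (hT : ∀ e ∈ (T.law π).support, ∀ h a,
      (Sum.inr (Sum.inl h, a) : ℕ ⊕ ((I₀ ⊕ I₁) × A)) ∈ (show List _ from e) →
        M.keep h = {s h}) : T.Forced M s := by
  induction T with
  | leaf u => trivial
  | chance n p next ih =>
    intro i hi
    refine ih i fun e he h a hm => hT (Episode.cons (Sum.inl (i : ℕ)) e) ?_ h a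
      (List.mem_cons_of_mem _ hm)
    rw [Tree.law_chance, PMF.mem_support_bind_iff]
    exact ⟨i, hi, (PMF.mem_support_map_iff _ _ _).2 ⟨e, he, rfl⟩⟩
  | decision k next ih =>
    have hsub : ∀ b ∈ M.avail k, ∀ e ∈ ((next b).law π).support,
        Episode.cons (Sum.inr (k, b)) e ∈ ((Tree.decision k next).law π).support := by
      intro b hb e he
      rw [Tree.law_decision]
      exact (PMF.mem_support_bind_iff _ _ _).2
        ⟨b, hπ k b hb, (PMF.mem_support_map_iff _ _ _).2 ⟨e, he, rfl⟩⟩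
    cases k with
    | inl k =>
      refine ⟨?_, ih (s k) fun e he h a hm => hT _ (hsub (s k) (hs k) e he) h a
        (List.mem_cons_of_mem _ hm)⟩
      obtain ⟨e, he⟩ := ((next (s k)).law π).support_nonempty
      exact hT _ (hsub (s k) (hs k) e he) k (s k) List.mem_cons_self
    | inr k =>
      exact fun b hb => ih b fun e he h a hm => hT _ (hsub b hb e he) h a
        (List.mem_cons_of_mem _ hm)

theorem Tree.Forced.keep_eq (hπ : Respects M.avail π) {T : Tree I₀ I₁ A} (hT : T.Forced M s)
    {e : Episode I₀ I₁ A} (he : e ∈ (T.law π).support) {h : I₀} {a : A}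
    (hm : (Sum.inr (Sum.inl h, a) : ℕ ⊕ ((I₀ ⊕ I₁) × A)) ∈ (show List _ from e)) :
    M.keep h = {s h} := by
  induction T generalizing e with
  | leaf u =>
    rw [Tree.law_leaf, PMF.mem_support_pure_iff] at he
    subst he
    exact absurd hm List.not_mem_nil
  | chance n p next ih =>
    rw [Tree.law_chance, PMF.mem_support_bind_iff] at he
    obtain ⟨i, hi, he⟩ := he
    obtain ⟨e', he', rfl⟩ := (PMF.mem_support_map_iff _ _ _).1 he
    rcases List.mem_cons.1 hm with hm | hm
    · exact absurd hm (by simp)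
    · exact ih i (hT i hi) he' hm
  | decision k next ih =>
    rw [Tree.law_decision, PMF.mem_support_bind_iff] at he
    obtain ⟨b, hb, he⟩ := he
    obtain ⟨e', he', rfl⟩ := (PMF.mem_support_map_iff _ _ _).1 he
    have hb' := hπ k b hb
    cases k with
    | inl k =>
      have hbs : b = s k := by
        have : b ∈ M.keep k := hb'
        rwa [hT.1, Finset.mem_singleton] at this
      rcases List.mem_cons.1 hm with hm | hm
      · obtain ⟨rfl, -⟩ : h = k ∧ a = b := by simpa using hm
        exact hT.1
      · exact ih b (hbs ▸ hT.2) he' hm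
    | inr k =>
      rcases List.mem_cons.1 hm with hm | hm
      · exact absurd hm (by simp)
      · exact ih b (hT b hb') he' hm

/-- At the forced nodes a mask-respecting victim has only one action, and following it never leaves
them. The victim's learning thus has no effect on what the opponent sees. -/
theorem Tree.Forced.law_eq (hπ : Respects M.avail π) {T : Tree I₀ I₁ A} (hT : T.Forced M s) :
    T.law π = T.law (Sum.elim (pureStrategy s) fun k => π (.inr k)) := by
  induction T with
  | leaf u => rfl
  | chance n p next ih =>
    rw [Tree.law_chance, Tree.law_chance]
    exact PMF.bind_congr_of_support fun i hi => by rw [ih i (hT i hi)]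
  | decision k next ih =>
    rw [Tree.law_decision, Tree.law_decision]
    cases k with
    | inl k =>
      have : π (.inl k) = PMF.pure (s k) := PMF.eq_pure_of_support fun b hb => by
        have : b ∈ M.keep k := hπ _ b hb
        rwa [hT.1, Finset.mem_singleton] at this
      simp only [this, Sum.elim_inl, pureStrategy, PMF.pure_bind]
      rw [ih (s k) hT.2]
    | inr k => exact PMF.bind_congr_of_support fun b hb => by rw [ih b (hT b (hπ _ b hb))]

theorem Tree.Forced.value_eq [Fintype A] {σ' : I₀ → PMF A} {τ : I₁ → PMF A}
    (hσ' : Respects M.keep σ') (hτ : Respects G.legal₁ τ) {T : Tree I₀ I₁ A}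
    (hT : T.Forced M s) :
    T.value (Sum.elim σ' τ) = T.value (Sum.elim (pureStrategy s) τ) := by
  induction T with
  | leaf u => rfl
  | chance n p next ih =>
    simp only [Tree.value]
    refine Finset.sum_congr rfl fun i _ => ?_
    by_cases hi : i ∈ p.support
    · rw [ih i (hT i hi)]
    · rw [(PMF.apply_eq_zero_iff p i).2 hi, ENNReal.toReal_zero, zero_mul, zero_mul]
  | decision k next ih =>
    simp only [Tree.value]
    cases k with
    | inl k =>
      have : σ' k = PMF.pure (s k) := PMF.eq_pure_of_support fun b hb => by
        have : b ∈ M.keep k := hσ' _ b hb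
        rwa [hT.1, Finset.mem_singleton] at this
      simp only [Sum.elim_inl, this, pureStrategy]
      refine sum_toReal_mul_congr (S := {s k}) (fun b hb => by simpa using hb) fun b hb => ?_
      rw [Finset.mem_singleton] at hb
      exact hb ▸ ih (s k) hT.2
    | inr k =>
      exact sum_toReal_mul_congr (hτ k) fun b hb => ih b (hT b hb)

end Forced

/-! ### Exploring strategies -/

section EpsGreedy

variable {G : Game I₀ I₁ A} {M : Mask G} (g : GreedyRule M) {ε : ℝ≥0} (hε1 : ε ≤ 1)
  (Q : Table I₀ I₁ A)

theorem epsGreedy_respects : Respects M.avail (epsGreedy g ε hε1 Q) := by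
  intro h a ha
  rw [epsGreedy, PMF.mem_support_bind_iff] at ha
  obtain ⟨b, -, hb⟩ := ha
  cases b with
  | false => exact (g.greedy Q h a (by simpa using hb)).1
  | true => simpa using hb

/-- The exploration branch alone gives `ε` divided by the number of available actions. The bound
does not depend on the table. -/
theorem le_epsGreedy [Fintype A] {h : I₀ ⊕ I₁} {a : A} (ha : a ∈ M.avail h) :
    (ε : ℝ) / Fintype.card A ≤ (epsGreedy g ε hε1 Q h a).toReal := by
  have h1 : (ε : ℝ≥0∞) * ((M.avail h).card : ℝ≥0∞)⁻¹ ≤ epsGreedy g ε hε1 Q h a := by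
    rw [epsGreedy, PMF.bind_apply]
    refine le_trans ?_ (ENNReal.le_tsum true)
    simp [PMF.uniformOfFinset_apply, ha]
  have h2 := ENNReal.toReal_mono (PMF.apply_ne_top _ _) h1
  rw [ENNReal.toReal_mul, ENNReal.toReal_inv, ENNReal.toReal_natCast, ENNReal.coe_toReal,
    ← div_eq_mul_inv] at h2
  refine le_trans (div_le_div_of_nonneg_left ε.2 ?_ ?_) h2
  · exact_mod_cast Finset.card_pos.2 ⟨a, ha⟩
  · exact_mod_cast Finset.card_le_univ _

theorem mem_support_epsGreedy [Fintype A] (hε0 : 0 < ε) {h : I₀ ⊕ I₁} {a : A}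
    (ha : a ∈ M.avail h) : a ∈ (epsGreedy g ε hε1 Q h).support := by
  have : Nonempty A := ⟨a⟩
  have h1 := le_epsGreedy g hε1 Q ha
  have h2 : 0 < (ε : ℝ) / Fintype.card A := div_pos hε0 (by exact_mod_cast Fintype.card_pos)
  rw [PMF.mem_support_iff]
  intro h0
  rw [h0, ENNReal.toReal_zero] at h1
  linarith

theorem epsGreedy_eq_pure {h : I₀} {a : A} (ha : M.keep h = {a}) :
    epsGreedy g ε hε1 Q (.inl h) = PMF.pure a :=
  PMF.eq_pure_of_support fun b hb => by
    have : b ∈ M.keep h := epsGreedy_respects g hε1 Q _ b hb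
    rwa [ha, Finset.mem_singleton] at this

/-- The capacity is a sum of nonnegative terms, so each one vanishes: an information set that some
episode of positive probability visits retains at most one action. -/
theorem forced_of_CACw_eq_zero [Fintype A] [Fintype I₀] (hε0 : 0 < ε)
    (hCAC : M.CACw (epsGreedy g ε hε1 Q) = 0) {s : I₀ → A} (hs : ∀ h, s h ∈ M.keep h) :
    G.root.Forced M s := by
  refine Tree.forced_of_support hs (fun h a ha => mem_support_epsGreedy g hε1 Q hε0 ha) _
    fun e he h a hm => ?_
  have hpos : 0 < G.reachProb (epsGreedy g ε hε1 Q) (.inl h) :=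
    PMF.toReal_toMeasure_pos_iff.2 ⟨e, he, a, hm⟩
  rw [Mask.CACw, Finset.sum_eq_zero_iff_of_nonneg fun h _ =>
    mul_nonneg (show 0 ≤ G.reachProb _ _ from ENNReal.toReal_nonneg)
      (by split_ifs <;> simp)] at hCAC
  have hc := (mul_eq_zero.1 (hCAC h (Finset.mem_univ h))).resolve_left hpos.ne'
  have hc' : (M.keep h).card ≤ 1 := by
    by_contra hlt
    rw [if_pos (not_le.1 hlt)] at hc
    exact one_ne_zero hc
  exact (Finset.eq_singleton_iff_unique_mem).2
    ⟨hs h, fun b hb => Finset.card_le_one.1 hc' b hb (s h) (hs h)⟩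

theorem keep_eq_of_reachProb_pos {s : I₀ → A} (hF : G.root.Forced M s) {h : I₀}
    (hh : 0 < G.reachProb (epsGreedy g ε hε1 Q) (.inl h)) : M.keep h = {s h} := by
  obtain ⟨e, he, a, hm⟩ := PMF.toReal_toMeasure_pos_iff.1 hh
  exact hF.keep_eq (epsGreedy_respects g hε1 Q) he hm

end EpsGreedy

/-! ### Own moves of an episode -/

section Moves

/-- The moves of player 1 in an episode. -/
def moves₁ (e : Episode I₀ I₁ A) : List ((I₀ ⊕ I₁) × A) := movesOf Sum.isRight e

theorem moves₁_nil : moves₁ (Episode.nil : Episode I₀ I₁ A) = [] := rfl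

theorem moves₁_cons_inl (i : ℕ) (e : Episode I₀ I₁ A) :
    moves₁ (Episode.cons (.inl i) e) = moves₁ e := rfl

theorem moves₁_cons_victim (k : I₀) (a : A) (e : Episode I₀ I₁ A) :
    moves₁ (Episode.cons (.inr (.inl k, a)) e) = moves₁ e := rfl

theorem moves₁_cons_opponent (k : I₁) (a : A) (e : Episode I₀ I₁ A) :
    moves₁ (Episode.cons (.inr (.inr k, a)) e) = (.inr k, a) :: moves₁ e := rfl

theorem outcome_chance (n : ℕ) (p : PMF (Fin n)) (next : Fin n → Tree I₀ I₁ A) (i : Fin n)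
    (e : Episode I₀ I₁ A) :
    (Tree.chance n p next).outcome (Episode.cons (.inl (i : ℕ)) e) = (next i).outcome e := by
  simp [Tree.outcome, Episode.cons]

theorem outcome_decision (h : I₀ ⊕ I₁) (next : A → Tree I₀ I₁ A) (a : A) (e : Episode I₀ I₁ A) :
    (Tree.decision h next).outcome (Episode.cons (.inr (h, a)) e) = (next a).outcome e := rfl

theorem fst_isOwn_of_mem_movesOf {f : I₀ ⊕ I₁ → Bool} {e : List (ℕ ⊕ ((I₀ ⊕ I₁) × A))}
    {h : I₀ ⊕ I₁} (hh : h ∈ (movesOf f e).map Prod.fst) : f h = true := by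
  obtain ⟨x, hx, rfl⟩ := List.mem_map.1 hh
  obtain ⟨y, -, hy⟩ := List.mem_filterMap.1 hx
  cases y with
  | inl i => simp at hy
  | inr m =>
    simp only [Option.ite_none_right_eq_some, Option.some.injEq] at hy
    exact hy.2 ▸ hy.1

/-- Each own move lengthens the own history, while an information set has a fixed one, so none
recurs in an episode. The prefix claim carries the induction. -/
theorem Tree.Recalls.nodup_moves₁ {G : Game I₀ I₁ A} {seq : I₁ → List (I₁ × A)}
    {π : I₀ ⊕ I₁ → PMF A} (hπ : Respects G.legal π) {T : Tree I₀ I₁ A} {pre : List (I₁ × A)}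
    (hT : T.Recalls G seq pre) {e : Episode I₀ I₁ A} (he : e ∈ (T.law π).support) :
    ((moves₁ e).map Prod.fst).Nodup ∧
      ∀ k, Sum.inr k ∈ (moves₁ e).map Prod.fst → pre <+: seq k := by
  induction T generalizing e pre with
  | leaf u =>
    rw [Tree.law_leaf, PMF.mem_support_pure_iff] at he
    subst he
    simp [moves₁_nil]
  | chance n p next ih =>
    rw [Tree.law_chance, PMF.mem_support_bind_iff] at he
    obtain ⟨i, -, he⟩ := he
    obtain ⟨e', he', rfl⟩ := (PMF.mem_support_map_iff _ _ _).1 he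
    exact ih i (hT i) (e := e') he'
  | decision k next ih =>
    rw [Tree.law_decision, PMF.mem_support_bind_iff] at he
    obtain ⟨b, hb, he⟩ := he
    obtain ⟨e', he', rfl⟩ := (PMF.mem_support_map_iff _ _ _).1 he
    cases k with
    | inl k => exact ih b (hT b (hπ _ b hb)) (e := e') he'
    | inr k =>
      obtain ⟨h1, h2⟩ := ih b (hT.2 b (hπ _ b hb)) he'
      rw [moves₁_cons_opponent, List.map_cons]
      refine ⟨List.nodup_cons.2 ⟨fun hk => ?_, h1⟩, fun k' hk' => ?_⟩
      · have := (h2 k hk).length_le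
        simp [hT.1] at this
      · rcases List.mem_cons.1 hk' with hk' | hk'
        · rw [Sum.inr.inj hk', hT.1]
        · exact (List.prefix_append _ _).trans (h2 k' hk')

/-- The target of a learning update that is followed by the moves `l`, when `u` is the final payoff
and `V` gives the values of the information sets. -/
def nextTarget (V : I₀ ⊕ I₁ → ℝ) (u : ℝ) : List ((I₀ ⊕ I₁) × A) → ℝ
  | [] => u
  | (h, _) :: _ => V h

theorem nextTarget_congr {V V' : I₀ ⊕ I₁ → ℝ} {l : List ((I₀ ⊕ I₁) × A)}
    (hV : ∀ h ∈ l.map Prod.fst, V h = V' h) (u : ℝ) : nextTarget V u l = nextTarget V' u l := by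
  cases l with
  | nil => rfl
  | cons x l => exact hV x.1 (by simp)

theorem abs_nextTarget_le {V : I₀ ⊕ I₁ → ℝ} {u C : ℝ} (hV : ∀ h, |V h| ≤ C) (hu : |u| ≤ C)
    (l : List ((I₀ ⊕ I₁) × A)) : |nextTarget V u l| ≤ C := by
  cases l with
  | nil => exact hu
  | cons x l => exact hV x.1

variable [DecidableEq I₀] [DecidableEq I₁] [DecidableEq A]

/-- The moves after the first occurrence of the move `m`. -/
def movesAfter (m : (I₀ ⊕ I₁) × A) :
    List ((I₀ ⊕ I₁) × A) → Option (List ((I₀ ⊕ I₁) × A))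
  | [] => none
  | x :: l => if x = m then some l else movesAfter m l

theorem movesAfter_of_notMem {m : (I₀ ⊕ I₁) × A} {l : List ((I₀ ⊕ I₁) × A)} (hm : m ∉ l) :
    movesAfter m l = none := by
  induction l with
  | nil => rfl
  | cons x l ih =>
    rw [List.mem_cons, not_or] at hm
    rw [movesAfter, if_neg (Ne.symm hm.1), ih hm.2]

theorem subset_of_movesAfter {m : (I₀ ⊕ I₁) × A} {l l' : List ((I₀ ⊕ I₁) × A)}
    (hl : movesAfter m l = some l') : l' ⊆ l := by
  induction l with
  | nil => simp [movesAfter] at hl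
  | cons x l ih =>
    rw [movesAfter] at hl
    split_ifs at hl with hx
    · exact Option.some.inj hl ▸ List.subset_cons_self _ _
    · exact List.Subset.trans (ih hl) (List.subset_cons_self _ _)

/-- The indicator of the event that the move `m` of player 1 occurs in the episode. -/
def visit (m : (I₀ ⊕ I₁) × A) (e : Episode I₀ I₁ A) : ℝ :=
  (movesAfter m (moves₁ e)).elim 0 fun _ => 1

theorem visit_eq_zero_or_one (m : (I₀ ⊕ I₁) × A) (e : Episode I₀ I₁ A) :
    visit m e = 0 ∨ visit m e = 1 := by
  rw [visit]
  cases movesAfter m (moves₁ e) <;> simp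

/-- Free of `Nodup`, because the bound on squared steps must hold for every sequence of records, not
just almost surely. -/
theorem elim_movesAfter_le_countP (m : (I₀ ⊕ I₁) × A) (l : List ((I₀ ⊕ I₁) × A)) :
    (movesAfter m l).elim (0 : ℝ) (fun _ => 1) ≤ l.countP fun x => x = m := by
  induction l with
  | nil => simp [movesAfter]
  | cons x l ih =>
    rw [movesAfter, List.countP_cons]
    by_cases hx : x = m
    · simp [hx]
    · simpa [hx] using ih

theorem elim_movesAfter_eq_countP (m : (I₀ ⊕ I₁) × A) {l : List ((I₀ ⊕ I₁) × A)}
    (hl : l.Nodup) : (movesAfter m l).elim (0 : ℝ) (fun _ => 1) = l.countP fun x => x = m := by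
  induction l with
  | nil => simp [movesAfter]
  | cons x l ih =>
    rw [List.nodup_cons] at hl
    rw [movesAfter, List.countP_cons]
    by_cases hx : x = m
    · have : l.countP (fun x => x = m) = 0 :=
        List.countP_eq_zero.2 fun y hy h' => hl.1 (by
          have : y = m := by simpa using h'
          rwa [hx, ← this])
      simp [hx, this]
    · simpa [hx] using ih hl.2

end Moves

/-! ### The learning updates of one episode -/

section Learn

theorem inr_notMem_movesOf_isLeft (e : List (ℕ ⊕ ((I₀ ⊕ I₁) × A))) (h : I₁) :
    Sum.inr h ∉ (movesOf Sum.isLeft e).map Prod.fst :=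
  fun hh => by simpa using fst_isOwn_of_mem_movesOf hh

section TableMax

variable {G : Game I₀ I₁ A} (M : Mask G)

/-- The largest Q-value of an available action. -/
def Mask.tableMax (Q : Table I₀ I₁ A) (h : I₀ ⊕ I₁) : ℝ :=
  (M.avail h).sup' (M.avail_nonempty h) (Q h)

theorem Mask.tableMax_congr {Q Q' : Table I₀ I₁ A} {h : I₀ ⊕ I₁} (hQ : Q h = Q' h) :
    M.tableMax Q h = M.tableMax Q' h := by
  rw [Mask.tableMax, Mask.tableMax, hQ]

theorem Mask.abs_tableMax_le {Q : Table I₀ I₁ A} {C : ℝ} (hQ : ∀ h a, |Q h a| ≤ C)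
    (h : I₀ ⊕ I₁) : |M.tableMax Q h| ≤ C := by
  obtain ⟨a, -, ha⟩ := Finset.exists_mem_eq_sup' (M.avail_nonempty h) (Q h)
  rw [Mask.tableMax, ha]
  exact hQ h a

end TableMax

variable [DecidableEq I₀] [DecidableEq I₁] [DecidableEq A] {G : Game I₀ I₁ A} (M : Mask G)
  (α : ℕ → ℝ)

theorem Memory.step_Q_self (m : Memory I₀ I₁ A) (h : I₀ ⊕ I₁) (a : A) (y : ℝ) :
    (m.step α h a y).Q h a = m.Q h a + α (m.visits h a) * (y - m.Q h a) := by
  simp [Memory.step]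

theorem Memory.step_Q_of_ne (m : Memory I₀ I₁ A) {h k : I₀ ⊕ I₁} {a b : A} (y : ℝ)
    (hkb : (h, a) ≠ (k, b)) : (m.step α h a y).Q k b = m.Q k b := by
  by_cases hk : k = h
  · subst hk
    have : b ≠ a := fun h => hkb (by rw [h])
    simp [Memory.step, this]
  · simp [Memory.step, hk]

theorem Memory.step_Q_of_ne_fst (m : Memory I₀ I₁ A) {h k : I₀ ⊕ I₁} (a : A) (y : ℝ)
    (hk : k ≠ h) : (m.step α h a y).Q k = m.Q k := by
  simp [Memory.step, hk]

theorem Memory.step_visits (m : Memory I₀ I₁ A) (h k : I₀ ⊕ I₁) (a b : A) (y : ℝ) :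
    (m.step α h a y).visits k b = m.visits k b + if (h, a) = (k, b) then 1 else 0 := by
  by_cases hk : k = h
  · subst hk
    by_cases hb : b = a
    · simp [Memory.step, hb]
    · simp [Memory.step, hb, Ne.symm hb]
  · simp [Memory.step, hk, Ne.symm hk]

theorem Memory.learn_cons (u : ℝ) (m : Memory I₀ I₁ A) (h : I₀ ⊕ I₁) (a : A)
    (l : List ((I₀ ⊕ I₁) × A)) :
    Memory.learn M α u m ((h, a) :: l)
      = Memory.learn M α u (m.step α h a (nextTarget (M.tableMax m.Q) u l)) l := by
  cases l with
  | nil => rfl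
  | cons x l => rfl

theorem Memory.learn_Q_of_notMem (u : ℝ) (m : Memory I₀ I₁ A) {l : List ((I₀ ⊕ I₁) × A)}
    {k : I₀ ⊕ I₁} (hk : k ∉ l.map Prod.fst) : (Memory.learn M α u m l).Q k = m.Q k := by
  induction l generalizing m with
  | nil => rfl
  | cons x l ih =>
    rw [List.map_cons, List.mem_cons, not_or] at hk
    rw [Memory.learn_cons, ih _ hk.2, Memory.step_Q_of_ne_fst _ _ _ _ hk.1]

theorem Memory.learn_visits (u : ℝ) (m : Memory I₀ I₁ A) (l : List ((I₀ ⊕ I₁) × A))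
    (k : I₀ ⊕ I₁) (b : A) :
    (Memory.learn M α u m l).visits k b = m.visits k b + l.countP fun x => x = (k, b) := by
  induction l generalizing m with
  | nil => rfl
  | cons x l ih =>
    obtain ⟨h, a⟩ := x
    rw [Memory.learn_cons, ih, Memory.step_visits, List.countP_cons]
    simp only [decide_eq_true_eq]
    omega

/-- Updates run forward in time and no information set repeats, so each target reads a row that this
episode has not yet changed: all targets come from the old table. -/
theorem Memory.learn_Q (u : ℝ) (m : Memory I₀ I₁ A) {l : List ((I₀ ⊕ I₁) × A)}
    (hl : (l.map Prod.fst).Nodup) (k : I₀ ⊕ I₁) (b : A) :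
    (Memory.learn M α u m l).Q k b = m.Q k b + (movesAfter (k, b) l).elim 0 fun l' =>
      α (m.visits k b) * (nextTarget (M.tableMax m.Q) u l' - m.Q k b) := by
  induction l generalizing m with
  | nil => simp [Memory.learn, movesAfter]
  | cons x l ih =>
    obtain ⟨h, a⟩ := x
    rw [List.map_cons, List.nodup_cons] at hl
    rw [Memory.learn_cons, ih _ hl.2, movesAfter]
    by_cases hx : (h, a) = (k, b)
    · have hn : movesAfter (k, b) l = none := movesAfter_of_notMem fun hm =>
        hl.1 (List.mem_map.2 ⟨(k, b), hm, (congrArg Prod.fst hx).symm⟩)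
      rw [if_pos hx, hn]
      obtain ⟨rfl, rfl⟩ := Prod.mk.inj hx
      simp [Memory.step_Q_self]
    · rw [if_neg hx, Memory.step_Q_of_ne _ _ _ hx, Memory.step_visits, if_neg hx, add_zero]
      cases hma : movesAfter (k, b) l with
      | none => rfl
      | some l' =>
        have : nextTarget (M.tableMax (m.step α h a (nextTarget (M.tableMax m.Q) u l)).Q) u l'
            = nextTarget (M.tableMax m.Q) u l' := nextTarget_congr (fun h' hh' => by
          refine M.tableMax_congr (Memory.step_Q_of_ne_fst _ _ _ _ ?_)
          rintro rfl
          exact hl.1 (List.map_subset _ (subset_of_movesAfter hma) hh')) u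
        simp [this]

/-- Each update is a convex combination of the old value and a target, both bounded by `C`. -/
theorem Memory.learn_abs_le (hα : ∀ n, α n ∈ Set.Ioo (0 : ℝ) 1) {u C : ℝ} (hu : |u| ≤ C)
    (m : Memory I₀ I₁ A) (hm : ∀ h a, |m.Q h a| ≤ C) (l : List ((I₀ ⊕ I₁) × A)) (h : I₀ ⊕ I₁)
    (a : A) : |(Memory.learn M α u m l).Q h a| ≤ C := by
  induction l generalizing m with
  | nil => exact hm h a
  | cons x l ih =>
    obtain ⟨k, b⟩ := x
    rw [Memory.learn_cons]
    refine ih _ fun h' a' => ?_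
    by_cases hx : (k, b) = (h', a')
    · obtain ⟨rfl, rfl⟩ := Prod.mk.inj hx
      rw [Memory.step_Q_self]
      have h1 := abs_le.1 (abs_nextTarget_le (fun h => M.abs_tableMax_le hm h) hu l)
      have h2 := abs_le.1 (hm k b)
      have h3 := hα (m.visits k b)
      rw [abs_le]
      constructor <;> nlinarith [h1.1, h1.2, h2.1, h2.2, h3.1, h3.2]
    · rw [Memory.step_Q_of_ne _ _ _ hx]
      exact hm h' a'

theorem Memory.afterEpisode_abs_le (hα : ∀ n, α n ∈ Set.Ioo (0 : ℝ) 1) {C : ℝ}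
    (hC : ∀ e, |G.root.outcome e| ≤ C) (m : Memory I₀ I₁ A) (hm : ∀ h a, |m.Q h a| ≤ C)
    (e : Episode I₀ I₁ A) (h : I₀ ⊕ I₁) (a : A) : |(m.afterEpisode M α e).Q h a| ≤ C :=
  Memory.learn_abs_le M α hα (by rw [abs_neg]; exact hC e) _
    (Memory.learn_abs_le M α hα (hC e) _ hm _) _ h a

theorem Memory.afterEpisode_visits (m : Memory I₀ I₁ A) (e : Episode I₀ I₁ A) (h : I₁) (a : A) :
    (m.afterEpisode M α e).visits (.inr h) a
      = m.visits (.inr h) a + (moves₁ e).countP fun x => x = (.inr h, a) := by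
  rw [Memory.afterEpisode, Memory.learn_visits, Memory.learn_visits,
    List.countP_eq_zero.2 fun x hm hx => inr_notMem_movesOf_isLeft e h
      (List.mem_map.2 ⟨x, hm, by rw [of_decide_eq_true hx]⟩)]
  rfl

/-- The victim's updates come first but touch only rows `Sum.inl`, so the opponent still learns from
`m`. -/
theorem Memory.afterEpisode_Q (m : Memory I₀ I₁ A) {e : Episode I₀ I₁ A}
    (he : ((moves₁ e).map Prod.fst).Nodup) (h : I₁) (a : A) :
    (m.afterEpisode M α e).Q (.inr h) a
      = m.Q (.inr h) a + α (m.visits (.inr h) a) *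
        (movesAfter (.inr h, a) (moves₁ e)).elim 0 fun l' =>
          nextTarget (M.tableMax m.Q) (-G.root.outcome e) l' - m.Q (.inr h) a := by
  have hQ := fun k => Memory.learn_Q_of_notMem M α (G.root.outcome e) m
    (inr_notMem_movesOf_isLeft e k)
  have hv := Memory.learn_visits M α (G.root.outcome e) m (movesOf Sum.isLeft e) (.inr h) a
  rw [List.countP_eq_zero.2 fun x hm hx => inr_notMem_movesOf_isLeft e h
      (List.mem_map.2 ⟨x, hm, by rw [of_decide_eq_true hx]⟩), add_zero] at hv
  change (Memory.learn M α (-G.root.outcome e)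
    (Memory.learn M α (G.root.outcome e) m (movesOf Sum.isLeft e)) (moves₁ e)).Q _ _ = _
  rw [Memory.learn_Q M α _ _ he, hQ, hv]
  congr 1
  cases hma : movesAfter (Sum.inr h, a) (moves₁ e) with
  | none => simp
  | some l' =>
    simp only [Option.elim_some]
    rw [nextTarget_congr (V' := M.tableMax m.Q) fun k hk => ?_]
    have := fst_isOwn_of_mem_movesOf (List.map_subset _ (subset_of_movesAfter hma) hk)
    obtain ⟨k, rfl⟩ := Sum.isRight_iff.1 this
    exact M.tableMax_congr (hQ k)

end Learn

/-! ### Expected updates -/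

section Expected

/-- The probability that player 1 makes the moves `l` when chance and player 0 lead to them. -/
def ownProd (τ : I₁ → PMF A) (l : List (I₁ × A)) : ℝ := (l.map fun x => (τ x.1 x.2).toReal).prod

theorem ownProd_concat (τ : I₁ → PMF A) (l : List (I₁ × A)) (k : I₁) (b : A) :
    ownProd τ (l ++ [(k, b)]) = ownProd τ l * (τ k b).toReal := by
  simp [ownProd]

theorem pow_le_ownProd {G : Game I₀ I₁ A} {τ : I₁ → PMF A} {δ : ℝ} (hδ : 0 ≤ δ) (hτ : ∀ k, ∀ b ∈ G.legal₁ k, δ ≤ (τ k b).toReal)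
    {l : List (I₁ × A)} (hl : LegalMoves G l) : δ ^ l.length ≤ ownProd τ l := by
  induction l with
  | nil => simp [ownProd]
  | cons x l ih =>
    have h1 := hτ x.1 x.2 (hl x List.mem_cons_self)
    have h2 := ih fun y hy => hl y (List.mem_cons_of_mem _ hy)
    rw [ownProd, List.map_cons, List.prod_cons, List.length_cons, pow_succ']
    exact mul_le_mul h1 h2 (pow_nonneg hδ _) (hδ.trans h1)

variable [Fintype A]

/-- The right side is free of `τ`: the target stops at the next own information set and uses its
table value. Exploration therefore does not bias the target. -/
theorem Tree.integral_nextTarget (σ : I₀ → PMF A) (τ : I₁ → PMF A) (V : I₀ ⊕ I₁ → ℝ)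
    (T : Tree I₀ I₁ A) :
    ∫ e, nextTarget V (-T.outcome e) (moves₁ e) ∂(T.law (Sum.elim σ τ)).toMeasure
      = T.nextVal σ fun k _ => V (.inr k) := by
  induction T with
  | leaf u => rw [Tree.integral_law_leaf]; rfl
  | chance n p next ih =>
    rw [Tree.integral_law_chance, Tree.nextVal]
    simp_rw [outcome_chance, moves₁_cons_inl, ih]
  | decision k next ih =>
    rw [Tree.integral_law_decision]
    simp_rw [outcome_decision]
    cases k with
    | inl k => simp_rw [moves₁_cons_victim, ih]; rfl
    | inr k =>
      simp_rw [moves₁_cons_opponent, nextTarget, integral_const, probReal_univ, one_smul]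
      rw [← Finset.sum_mul, sum_toReal_eq_one, one_mul, Tree.nextVal]

variable [DecidableEq I₀] [DecidableEq I₁] [DecidableEq A]
  {G : Game I₀ I₁ A} {σ : I₀ → PMF A} {τ : I₁ → PMF A} {seq : I₁ → List (I₁ × A)} {h : I₁} {a : A}

/-- The probability of a path factors into own moves and moves of chance and victim; by perfect
recall the own factor is `ownProd τ (seq h)` at every node of `h` and comes out of the sum. Carrying
`ownProd τ pre` on the left avoids conditioning on possibly null histories. -/
theorem Tree.Recalls.integral_movesAfter (hσ : Respects (fun k => G.legal (.inl k)) σ)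
    (hτ : Respects G.legal₁ τ) (ha : a ∈ G.legal₁ h) (c : List ((I₀ ⊕ I₁) × A) → ℝ → ℝ)
    {T : Tree I₀ I₁ A} {pre : List (I₁ × A)} (hT : T.Recalls G seq pre) :
    ownProd τ pre * ∫ e, ((movesAfter (.inr h, a) (moves₁ e)).elim 0 fun l => c l (T.outcome e))
        ∂(T.law (Sum.elim σ τ)).toMeasure
      = ownProd τ (seq h) * (τ h a).toReal * T.nodeSum G.legal₁ σ h fun next =>
        ∫ e, c (moves₁ e) ((next a).outcome e) ∂((next a).law (Sum.elim σ τ)).toMeasure := by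
  induction T generalizing pre with
  | leaf u =>
    rw [Tree.integral_law_leaf]
    simp [moves₁_nil, movesAfter, Tree.nodeSum]
  | chance n p next ih =>
    rw [Tree.integral_law_chance, Tree.nodeSum, Finset.mul_sum, Finset.mul_sum]
    refine Finset.sum_congr rfl fun i _ => ?_
    simp_rw [outcome_chance, moves₁_cons_inl]
    have := ih i (hT i)
    linear_combination (p i).toReal * this
  | decision k next ih =>
    rw [Tree.integral_law_decision]
    simp_rw [outcome_decision]
    cases k with
    | inl k =>
      rw [Tree.nodeSum, Finset.mul_sum, Finset.mul_sum]
      refine Finset.sum_congr rfl fun b _ => ?_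
      simp_rw [moves₁_cons_victim, Sum.elim_inl]
      have := mul_eq_zero_of_support (hσ k) (a := b) fun hb => sub_eq_zero.2 (ih b (hT b hb))
      linear_combination this
    | inr k =>
      simp_rw [moves₁_cons_opponent, Sum.elim_inr]
      -- A move other than `(h, a)` is skipped by `movesAfter`, and its probability joins the own
      -- history.
      have key : ∀ b ∈ G.legal₁ k, ((Sum.inr k, b) : (I₀ ⊕ I₁) × A) ≠ (.inr h, a) →
          ownProd τ pre * ((τ k b).toReal * ∫ e, ((movesAfter (.inr h, a)
            ((.inr k, b) :: moves₁ e)).elim 0 fun l => c l ((next b).outcome e))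
              ∂((next b).law (Sum.elim σ τ)).toMeasure)
            = ownProd τ (seq h) * (τ h a).toReal *
              (next b).nodeSum G.legal₁ σ h fun next => ∫ e, c (moves₁ e) ((next a).outcome e)
                ∂((next a).law (Sum.elim σ τ)).toMeasure := by
        intro b hb hne
        simp_rw [movesAfter, if_neg hne]
        rw [← ih b (hT.2 b hb), ownProd_concat]
        ring
      rw [Finset.mul_sum, ← Finset.sum_subset (Finset.subset_univ (G.legal₁ k)) fun b _ hb => by
        rw [(PMF.apply_eq_zero_iff _ b).2 fun hb' => hb (hτ k b hb'), ENNReal.toReal_zero,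
          zero_mul, mul_zero]]
      rw [Tree.nodeSum]
      split_ifs with hk
      · subst hk
        rw [Finset.sum_eq_single_of_mem a ha]
        · simp_rw [movesAfter, if_true, Option.elim_some]
          rw [hT.1]
          ring
        · intro b hb hba
          rw [key b hb (by simpa using hba), (hT.2 b hb).nodeSum_eq_zero hσ, mul_zero]
          intro hp
          have := hp.length_le
          simp [hT.1] at this
      · rw [Finset.mul_sum]
        exact Finset.sum_congr rfl fun b hb => key b hb (by simp [hk])

variable (hG : G.root.Recalls G seq []) (hσ : Respects (fun k => G.legal (.inl k)) σ)
  (hτ : Respects G.legal₁ τ) (ha : a ∈ G.legal₁ h)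
include hG hσ hτ ha

theorem Game.integral_visit :
    ∫ e, visit (.inr h, a) e
        ∂(G.root.law (Sum.elim σ τ)).toMeasure
      = ownProd τ (seq h) * (τ h a).toReal * G.reachWeight σ h := by
  have := hG.integral_movesAfter hσ hτ ha (fun _ _ => 1)
  simp only [ownProd, List.map_nil, List.prod_nil, one_mul, integral_const,
    probReal_univ, one_smul] at this
  exact this

theorem Game.integral_target_sub (V : I₀ ⊕ I₁ → ℝ) (x : ℝ) (hh : G.Reachable₁ σ h) :
    ∫ e, ((movesAfter (.inr h, a) (moves₁ e)).elim 0 fun l =>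
        nextTarget V (-G.root.outcome e) l - x) ∂(G.root.law (Sum.elim σ τ)).toMeasure
      = ownProd τ (seq h) * (τ h a).toReal * G.reachWeight σ h *
        (G.bellman σ (fun k => V (.inr k)) h a - x) := by
  have := hG.integral_movesAfter hσ hτ ha fun l u => nextTarget V (-u) l - x
  simp only [ownProd, List.map_nil, List.prod_nil, one_mul] at this
  rw [this]
  have h2 : ∀ T : Tree I₀ I₁ A, ∫ e, (nextTarget V (-T.outcome e) (moves₁ e) - x)
      ∂(T.law (Sum.elim σ τ)).toMeasure = T.nextVal σ (fun k _ => V (.inr k)) - x := fun T => by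
    rw [integral_sub (T.integrable_law _) (integrable_const _), T.integral_nextTarget,
      integral_const, probReal_univ, one_smul]
  simp_rw [h2]
  rw [Tree.nodeSum_sub, Tree.nodeSum_const, Game.bellman]
  have h3 : G.reachWeight σ h ≠ 0 := ne_of_gt hh
  have h4 : G.root.nodeSum G.legal₁ σ h (fun _ => 1) = G.reachWeight σ h := rfl
  rw [h4, mul_assoc (_ * _) (G.reachWeight σ h), mul_sub (G.reachWeight σ h),
    mul_div_cancel₀ _ h3, mul_comm x]
  rfl

end Expected

/-! ### Averaging recursions -/

/-- Once `c` stays within `η / 2` of `L`, the excess of the error over `η / 2` shrinks by factors `1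
- a n ≤ exp (-a n)`, whose product tends to zero because the weights diverge. -/
theorem tendsto_of_averaging {x a c : ℕ → ℝ} {L : ℝ}
    (hx : ∀ n, x (n + 1) = (1 - a n) * x n + a n * c n) (ha : ∀ n, a n ∈ Set.Icc (0 : ℝ) 1)
    (hs : Tendsto (fun n => ∑ i ∈ Finset.range n, a i) atTop atTop)
    (hc : Tendsto c atTop (𝓝 L)) : Tendsto x atTop (𝓝 L) := by
  rw [Metric.tendsto_atTop]
  intro η hη
  obtain ⟨N, hN⟩ := Metric.tendsto_atTop.1 hc (η / 2) (half_pos hη)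
  have key : ∀ n, |x (N + n) - L| ≤ η / 2 + |x N - L| *
      Real.exp (-(∑ i ∈ Finset.range (N + n), a i - ∑ i ∈ Finset.range N, a i)) := by
    intro n
    induction n with
    | zero => simp; positivity
    | succ n ih =>
      have h1 : |c (N + n) - L| ≤ η / 2 := by
        have := hN (N + n) (Nat.le_add_right _ _)
        rw [Real.dist_eq] at this
        exact this.le
      have h2 : x (N + (n + 1)) - L
          = (1 - a (N + n)) * (x (N + n) - L) + a (N + n) * (c (N + n) - L) := by
        rw [← add_assoc, hx]; ring
      obtain ⟨h3, h4⟩ := ha (N + n)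
      have h5 : Real.exp (-(∑ i ∈ Finset.range (N + (n + 1)), a i - ∑ i ∈ Finset.range N, a i))
          = Real.exp (-a (N + n)) *
            Real.exp (-(∑ i ∈ Finset.range (N + n), a i - ∑ i ∈ Finset.range N, a i)) := by
        rw [← Real.exp_add, ← add_assoc, Finset.sum_range_succ]
        congr 1; ring
      rw [h2, h5]
      have h6 := Real.one_sub_le_exp_neg (a (N + n))
      set K := |x N - L| *
        Real.exp (-(∑ i ∈ Finset.range (N + n), a i - ∑ i ∈ Finset.range N, a i)) with hK
      have hK0 : 0 ≤ K := by positivity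
      calc |(1 - a (N + n)) * (x (N + n) - L) + a (N + n) * (c (N + n) - L)|
          ≤ (1 - a (N + n)) * |x (N + n) - L| + a (N + n) * |c (N + n) - L| := by
            refine (abs_add_le _ _).trans_eq ?_
            rw [abs_mul, abs_mul, abs_of_nonneg h3, abs_of_nonneg (sub_nonneg.2 h4)]
        _ ≤ (1 - a (N + n)) * (η / 2 + K) + a (N + n) * (η / 2) :=
            add_le_add (mul_le_mul_of_nonneg_left ih (sub_nonneg.2 h4))
              (mul_le_mul_of_nonneg_left h1 h3)
        _ = η / 2 + (1 - a (N + n)) * K := by ring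
        _ ≤ η / 2 + Real.exp (-a (N + n)) * K :=
            add_le_add le_rfl (mul_le_mul_of_nonneg_right h6 hK0)
        _ = _ := by rw [hK]; ring
  have hlim : Tendsto (fun n => |x N - L| *
      Real.exp (-(∑ i ∈ Finset.range n, a i - ∑ i ∈ Finset.range N, a i))) atTop (𝓝 0) := by
    rw [← mul_zero |x N - L|]
    refine Tendsto.const_mul _ (Real.tendsto_exp_neg_atTop_nhds_zero.comp ?_)
    exact tendsto_atTop_add_const_right _ _ hs
  obtain ⟨N', hN'⟩ := eventually_atTop.1 (hlim.eventually (gt_mem_nhds (half_pos hη)))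
  refine ⟨max N N', fun n hn => ?_⟩
  obtain ⟨m, rfl⟩ := Nat.exists_eq_add_of_le ((le_max_left _ _).trans hn)
  have h1 := key m
  have h2 := hN' (N + m) ((le_max_right _ _).trans hn)
  rw [Real.dist_eq]
  linarith

/-- Adding the noise still to come, `Z` minus the partial sum, to `x` gives a noiseless recursion
whose target is shifted by the same vanishing tail. -/
theorem tendsto_of_noisy_averaging {x a c z : ℕ → ℝ} {L Z : ℝ}
    (hx : ∀ n, x (n + 1) = (1 - a n) * x n + a n * c n + z n) (ha : ∀ n, a n ∈ Set.Icc (0 : ℝ) 1)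
    (hs : Tendsto (fun n => ∑ i ∈ Finset.range n, a i) atTop atTop)
    (hc : Tendsto c atTop (𝓝 L))
    (hz : Tendsto (fun n => ∑ i ∈ Finset.range n, z i) atTop (𝓝 Z)) :
    Tendsto x atTop (𝓝 L) := by
  have h1 : Tendsto (fun n => x n + (Z - ∑ i ∈ Finset.range n, z i)) atTop (𝓝 L) := by
    refine tendsto_of_averaging (a := a) (c := fun n => c n + (Z - ∑ i ∈ Finset.range n, z i))
      (fun n => ?_) ha hs ?_
    · rw [hx, Finset.sum_range_succ]; ring
    · simpa using hc.add ((tendsto_const_nhds (x := Z)).sub hz)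
  simpa using h1.sub ((tendsto_const_nhds (x := Z)).sub hz)

/-! ### Martingales of a chain with memory -/

section Chain

variable {E : Type*}

/-- Continue a finite sequence by a constant one. -/
def prolong {t : ℕ} (x : (_ : Finset.Iic t) → E) : ℕ → E :=
  fun i => if hi : i ≤ t then x ⟨i, Finset.mem_Iic.2 hi⟩ else x ⟨t, Finset.mem_Iic.2 le_rfl⟩

theorem frestrictLe_prolong {t : ℕ} (x : (_ : Finset.Iic t) → E) :
    Preorder.frestrictLe t (prolong x) = x := by
  ext i
  simp [prolong, Finset.mem_Iic.1 i.2]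

theorem eq_prolong_of_dependsOn {t : ℕ} {f : (ℕ → E) → ℝ} (hf : DependsOn f (Set.Iic t)) (ω : ℕ → E) :
    f ω = f (prolong (Preorder.frestrictLe t ω)) :=
  hf fun i hi => by simp [prolong, Set.mem_Iic.1 hi]

variable [MeasurableSpace E]

/-- Under `P`, entry `t + 1` of the sequence has the distribution `κ t`, given the entries
`0, …, t`. -/
def HasTransitions (P : Measure (ℕ → E)) (κ : (t : ℕ) → Kernel ((_ : Finset.Iic t) → E) E) : Prop :=
  ∀ t, P.map (Preorder.frestrictLe t) ⊗ₘ κ t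
    = P.map fun ω => (Preorder.frestrictLe t ω, ω (t + 1))

variable [DiscreteMeasurableSpace E] [Countable E]
  {P : Measure (ℕ → E)} [IsProbabilityMeasure P]
  {κ : (t : ℕ) → Kernel ((_ : Finset.Iic t) → E) E} [∀ t, IsMarkovKernel (κ t)]

theorem measurable_piLE_of_dependsOn {t : ℕ} {f : (ℕ → E) → ℝ} (hf : DependsOn f (Set.Iic t)) :
    Measurable[Filtration.piLE (X := fun _ : ℕ => E) t] f := by
  have : f = (fun x => f (prolong x)) ∘ Preorder.frestrictLe t := funext fun ω => eq_prolong_of_dependsOn hf ω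
  rw [this, Filtration.piLE_eq_comap_frestrictLe]
  exact Measurable.comp Measurable.of_discrete (comap_measurable _)

theorem measurable_of_dependsOn {t : ℕ} {f : (ℕ → E) → ℝ} (hf : DependsOn f (Set.Iic t)) :
    Measurable f :=
  (measurable_piLE_of_dependsOn hf).mono (Filtration.piLE.le t) le_rfl

theorem integrable_of_dependsOn {t : ℕ} {f : (ℕ → E) → ℝ} (hf : DependsOn f (Set.Iic t)) {C : ℝ}
    (hC : ∀ ω, |f ω| ≤ C) : Integrable f P :=
  Integrable.of_bound (measurable_of_dependsOn hf).aestronglyMeasurable C (Eventually.of_forall hC)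

/-- The tower rule: `f` is a function of the past and of entry `t + 1`, and the latter is integrated
first. -/
theorem HasTransitions.integral_eq_zero (hP : HasTransitions P κ) {t : ℕ} {f : (ℕ → E) → ℝ}
    (hf : DependsOn f (Set.Iic (t + 1))) {C : ℝ} (hC : ∀ ω, |f ω| ≤ C)
    (h0 : ∀ ω, ∫ e, f (Function.update ω (t + 1) e) ∂(κ t (Preorder.frestrictLe t ω)) = 0) :
    ∫ ω, f ω ∂P = 0 := by
  set ψ : ((_ : Finset.Iic t) → E) × E → ℝ := fun p =>
    f (Function.update (prolong p.1) (t + 1) p.2) with hψ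
  have hfψ : f = ψ ∘ fun ω => (Preorder.frestrictLe t ω, ω (t + 1)) := by
    funext ω
    refine hf fun i hi => ?_
    rcases Nat.le_succ_iff.1 (Set.mem_Iic.1 hi) with h | h
    · have : i ≠ t + 1 := by omega
      simp [this, prolong, h]
    · subst h; simp
  have hm : Measurable fun ω : ℕ → E => (Preorder.frestrictLe t ω, ω (t + 1)) := by fun_prop
  have hψm : Measurable ψ := Measurable.of_discrete
  rw [hfψ]
  change ∫ ω, ψ ((fun ω : ℕ → E => (Preorder.frestrictLe t ω, ω (t + 1))) ω) ∂P = 0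
  rw [← integral_map hm.aemeasurable hψm.aestronglyMeasurable, ← hP t]
  have : IsProbabilityMeasure (P.map (Preorder.frestrictLe (π := fun _ : ℕ => E) t)) :=
    Measure.isProbabilityMeasure_map (by fun_prop)
  rw [Measure.integral_compProd (Integrable.of_bound hψm.aestronglyMeasurable C
    (Eventually.of_forall fun p => hC _))]
  refine integral_eq_zero_of_ae (Eventually.of_forall fun x => ?_)
  have := h0 (prolong x)
  rwa [frestrictLe_prolong] at this

variable {D : ℕ → (ℕ → E) → ℝ}

/-- A factor that depends only on the past is constant under the inner integral. This provides both
the martingale property and the orthogonality of increments. -/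
theorem HasTransitions.integral_mul_eq_zero (hP : HasTransitions P κ) {t : ℕ}
    (hdep : DependsOn (D t) (Set.Iic (t + 1)))
    (h0 : ∀ ω, ∫ e, D t (Function.update ω (t + 1) e) ∂(κ t (Preorder.frestrictLe t ω)) = 0)
    {K : ℝ} (hK : ∀ ω, |D t ω| ≤ K) {f : (ℕ → E) → ℝ} (hf : DependsOn f (Set.Iic t)) {C : ℝ}
    (hC : ∀ ω, |f ω| ≤ C) : ∫ ω, f ω * D t ω ∂P = 0 := by
  refine hP.integral_eq_zero (C := C * K) (t := t) (fun x y hxy => ?_) (fun ω => ?_) fun ω => ?_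
  · rw [hf fun i hi => hxy i (Set.mem_Iic.2 ((Set.mem_Iic.1 hi).trans (Nat.le_succ t))), hdep hxy]
  · rw [abs_mul]
    exact mul_le_mul (hC ω) (hK ω) (abs_nonneg _) ((abs_nonneg _).trans (hC ω))
  · have : ∀ e, f (Function.update ω (t + 1) e) = f ω := fun e => hf fun i hi => by
      have : i ≠ t + 1 := by have := Set.mem_Iic.1 hi; omega
      simp [this]
    simp_rw [this, integral_const_mul, h0, mul_zero]

/-- The partial sums are a martingale whose second moments are the expected sums of squared
increments, hence at most `C`. Boundedness in L² gives boundedness in L¹, and Doob's theorem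
applies. -/
theorem HasTransitions.ae_exists_tendsto_sum (hP : HasTransitions P κ)
    (hdep : ∀ t, DependsOn (D t) (Set.Iic (t + 1)))
    (h0 : ∀ t ω, ∫ e, D t (Function.update ω (t + 1) e) ∂(κ t (Preorder.frestrictLe t ω)) = 0)
    {C : ℝ} (hC : ∀ n ω, ∑ t ∈ Finset.range n, D t ω ^ 2 ≤ C) :
    ∀ᵐ ω ∂P, ∃ c, Tendsto (fun n => ∑ t ∈ Finset.range n, D t ω) atTop (𝓝 c) := by
  have hD2 : ∀ t ω, D t ω ^ 2 ≤ C := fun t ω =>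
    (Finset.single_le_sum (f := fun t => D t ω ^ 2) (fun i _ => sq_nonneg _)
      (Finset.self_mem_range_succ t)).trans (hC (t + 1) ω)
  -- From `|x| ≤ 1 + x ^ 2`; the same inequality gives the L¹ bound at the end.
  have hK : ∀ t ω, |D t ω| ≤ 1 + C := fun t ω => by
    have := hD2 t ω
    rw [← sq_abs] at this
    nlinarith [sq_nonneg (|D t ω| - 1), abs_nonneg (D t ω)]
  set S : ℕ → (ℕ → E) → ℝ := fun n ω => ∑ t ∈ Finset.range n, D t ω with hS
  have hSdep : ∀ n, DependsOn (S n) (Set.Iic n) := fun n x y hxy =>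
    Finset.sum_congr rfl fun t ht => hdep t fun i hi => hxy i
      (Set.mem_Iic.2 ((Set.mem_Iic.1 hi).trans (Finset.mem_range.1 ht)))
  have hSb : ∀ n ω, |S n ω| ≤ n * (1 + C) := fun n ω => by
    refine (Finset.abs_sum_le_sum_abs _ _).trans ((Finset.sum_le_sum fun t _ => hK t ω).trans_eq ?_)
    simp [mul_add]
  have hSint : ∀ n, Integrable (S n) P := fun n => integrable_of_dependsOn (hSdep n) (hSb n)
  have hDint : ∀ t, Integrable (D t) P := fun t => integrable_of_dependsOn (hdep t) (hK t)
  have hmart : Martingale S (Filtration.piLE (X := fun _ : ℕ => E)) P := by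
    refine martingale_of_setIntegral_eq_succ (fun n => (measurable_piLE_of_dependsOn (hSdep n)).stronglyMeasurable)
      hSint fun n s hs => ?_
    have hs' : MeasurableSet s := Filtration.piLE.le n s hs
    simp only [hS, Finset.sum_range_succ]
    rw [integral_add (hSint n).integrableOn (hDint n).integrableOn, left_eq_add,
      ← integral_indicator hs']
    have hsd : DependsOn (s.indicator fun _ => (1 : ℝ)) (Set.Iic n) := by
      rw [Filtration.piLE_eq_comap_frestrictLe] at hs
      obtain ⟨s', -, rfl⟩ := hs
      intro x y hxy
      have : Preorder.frestrictLe n x = Preorder.frestrictLe n y :=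
        Preorder.dependsOn_frestrictLe n hxy
      classical
      simp only [Set.indicator_apply, Set.mem_preimage, this]
    have := hP.integral_mul_eq_zero (hdep n) (h0 n) (hK n) hsd (C := 1) fun ω => by
      by_cases h : ω ∈ s <;> simp [h]
    rw [← this]
    refine integral_congr_ae (Eventually.of_forall fun ω => ?_)
    by_cases h : ω ∈ s <;> simp [h]
  have hsq : ∀ n, ∫ ω, S n ω ^ 2 ∂P = ∫ ω, ∑ t ∈ Finset.range n, D t ω ^ 2 ∂P := by
    intro n
    induction n with
    | zero => simp [hS]
    | succ n ih =>
      have e1 : ∀ ω, S (n + 1) ω ^ 2 = S n ω ^ 2 + 2 * (S n ω * D n ω) + D n ω ^ 2 := fun ω => by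
        simp only [hS, Finset.sum_range_succ]; ring
      have i1 : Integrable (fun ω => S n ω ^ 2) P :=
        integrable_of_dependsOn (t := n) (fun x y hxy => by simp only [hSdep n hxy])
          (C := (n * (1 + C)) ^ 2) fun ω => by
            rw [abs_pow]; exact pow_le_pow_left₀ (abs_nonneg _) (hSb n ω) 2
      have i2 : Integrable (fun ω => D n ω ^ 2) P :=
        integrable_of_dependsOn (t := n + 1) (fun x y hxy => by simp only [hdep n hxy])
          (C := C) fun ω => by rw [abs_of_nonneg (sq_nonneg _)]; exact hD2 n ω
      have i3 : Integrable (fun ω => S n ω * D n ω) P :=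
        (hDint n).bdd_mul (measurable_of_dependsOn (hSdep n)).aestronglyMeasurable
          (Eventually.of_forall (hSb n))
      have i4 : Integrable (fun ω => ∑ t ∈ Finset.range n, D t ω ^ 2) P :=
        integrable_of_dependsOn (t := n) (fun x y hxy => Finset.sum_congr rfl fun t ht => by
          rw [hdep t fun i hi => hxy i
            (Set.mem_Iic.2 ((Set.mem_Iic.1 hi).trans (Finset.mem_range.1 ht)))])
          (C := C) fun ω => by
            rw [abs_of_nonneg (Finset.sum_nonneg fun i _ => sq_nonneg _)]; exact hC n ω
      simp_rw [e1, Finset.sum_range_succ]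
      rw [integral_add (f := fun ω => S n ω ^ 2 + 2 * (S n ω * D n ω)) (i1.add (i3.const_mul 2)) i2,
        integral_add i1 (i3.const_mul 2),
        integral_add i4 i2, integral_const_mul,
        hP.integral_mul_eq_zero (hdep n) (h0 n) (hK n) (hSdep n) (hSb n), ih]
      simp
  refine hmart.submartingale.exists_ae_tendsto_of_bdd (R := (1 + C).toNNReal) fun n => ?_
  rw [eLpNorm_one_eq_lintegral_enorm, ← ofReal_integral_norm_eq_lintegral_enorm (hSint n)]
  refine ENNReal.ofReal_le_ofReal ?_
  have hsqle : ∫ ω, S n ω ^ 2 ∂P ≤ C := by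
    rw [hsq]
    calc _ ≤ ∫ _, C ∂P := integral_mono_of_nonneg
            (Eventually.of_forall fun ω => Finset.sum_nonneg fun i _ => sq_nonneg _)
            (integrable_const C) (Eventually.of_forall fun ω => hC n ω)
      _ = C := by simp
  have i1 : Integrable (fun ω => S n ω ^ 2) P :=
    integrable_of_dependsOn (t := n) (fun x y hxy => by simp only [hSdep n hxy])
      (C := (n * (1 + C)) ^ 2) fun ω => by
        rw [abs_pow]; exact pow_le_pow_left₀ (abs_nonneg _) (hSb n ω) 2
  calc ∫ ω, ‖S n ω‖ ∂P ≤ ∫ ω, (1 + S n ω ^ 2) ∂P :=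
        integral_mono (hSint n).norm ((integrable_const 1).add i1) fun ω => by
          simp only [Real.norm_eq_abs]
          nlinarith [sq_nonneg (|S n ω| - 1), sq_abs (S n ω), abs_nonneg (S n ω)]
    _ = 1 + ∫ ω, S n ω ^ 2 ∂P := by rw [integral_add (integrable_const 1) i1]; simp
    _ ≤ 1 + C := by linarith

end Chain

/-! ### Exploring play against a forced victim -/

section Exploring

variable {G : Game I₀ I₁ A} {M : Mask G} {s : I₀ → A} {seq : I₁ → List (I₁ × A)}

theorem Mask.respects_pureStrategy (hs : ∀ h, s h ∈ M.keep h) :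
    Respects (fun k => G.legal (.inl k)) (pureStrategy s) := by
  intro k a ha
  simp only [pureStrategy, PMF.support_pure, Set.mem_singleton_iff] at ha
  exact ha ▸ M.keep_subset k (hs k)

theorem Mask.respects_legal {π : I₀ ⊕ I₁ → PMF A} (hπ : Respects M.avail π) :
    Respects G.legal π := by
  intro k a ha
  cases k with
  | inl k => exact M.keep_subset k (hπ _ a ha)
  | inr k => exact hπ (.inr k) a ha

theorem nodup_of_mem_support_epsGreedy (g : GreedyRule M) {ε : ℝ≥0} (hε1 : ε ≤ 1)
    (hG : G.root.Recalls G seq []) (Q : Table I₀ I₁ A) {e : Episode I₀ I₁ A}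
    (he : e ∈ (G.root.law (epsGreedy g ε hε1 Q)).support) : ((moves₁ e).map Prod.fst).Nodup :=
  (hG.nodup_moves₁ (M.respects_legal (epsGreedy_respects g hε1 Q)) he).1

variable [Fintype A] [DecidableEq I₁]

/-- The probability that an episode of exploring play for the table `Q` contains the move `a` at
`h`. -/
def visitProb (g : GreedyRule M) (ε : ℝ≥0) (hε1 : ε ≤ 1) (s : I₀ → A)
    (seq : I₁ → List (I₁ × A)) (Q : Table I₀ I₁ A) (h : I₁) (a : A) : ℝ :=
  ownProd (fun k => epsGreedy g ε hε1 Q (.inr k)) (seq h)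
    * (epsGreedy g ε hε1 Q (.inr h) a).toReal * G.reachWeight (pureStrategy s) h

variable (g : GreedyRule M) {ε : ℝ≥0} (hε1 : ε ≤ 1)
  (hG : G.root.Recalls G seq []) (hs : ∀ h, s h ∈ M.keep h) (hF : G.root.Forced M s)
  {h : I₁} (hh : G.Reachable₁ (pureStrategy s) h)
  {a : A} (ha : a ∈ G.legal₁ h)

include hG hs hh ha in
-- Reaching `(h, a)` takes a fixed number of legal own moves, each of probability at least `ε /
-- |A|`, and the remaining factor does not involve the table.
theorem exists_le_visitProb (hε0 : 0 < ε) :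
    ∃ δ > 0, ∀ Q, δ ≤ visitProb g ε hε1 s seq Q h a := by
  have : Nonempty A := ⟨a⟩
  have h0 : 0 < (ε : ℝ) / Fintype.card A := div_pos hε0 (by exact_mod_cast Fintype.card_pos)
  have hl : LegalMoves G (seq h) := hG.legalMoves (M.respects_pureStrategy hs) (fun _ => 1)
    (by simp [LegalMoves]) (ne_of_gt hh)
  refine ⟨((ε : ℝ) / Fintype.card A) ^ (seq h).length * ((ε : ℝ) / Fintype.card A)
    * G.reachWeight (pureStrategy s) h, mul_pos (mul_pos (pow_pos h0 _) h0) hh, fun Q => ?_⟩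
  have h1 : ∀ k, ∀ b ∈ G.legal₁ k,
      (ε : ℝ) / Fintype.card A ≤ (epsGreedy g ε hε1 Q (.inr k) b).toReal := fun k b hb =>
    le_epsGreedy g hε1 Q (h := .inr k) hb
  have h2 := pow_le_ownProd h0.le h1 hl
  exact mul_le_mul_of_nonneg_right (mul_le_mul h2 (h1 h a ha) h0.le ((pow_nonneg h0.le _).trans h2))
    (le_of_lt hh)

variable [DecidableEq I₀] [DecidableEq A]

include hG hs hF ha in
theorem integral_visit_epsGreedy (Q : Table I₀ I₁ A) :
    ∫ e, visit (.inr h, a) e ∂(G.root.law (epsGreedy g ε hε1 Q)).toMeasure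
      = visitProb g ε hε1 s seq Q h a := by
  rw [hF.law_eq (epsGreedy_respects g hε1 Q)]
  exact Game.integral_visit hG (M.respects_pureStrategy hs)
    (fun k b hb => epsGreedy_respects g hε1 Q (.inr k) b hb) ha

include hG hs hF ha in
theorem visitProb_mem_Icc (Q : Table I₀ I₁ A) :
    visitProb g ε hε1 s seq Q h a ∈ Set.Icc (0 : ℝ) 1 := by
  rw [← integral_visit_epsGreedy g hε1 hG hs hF ha Q]
  have h01 := fun e : Episode I₀ I₁ A => visit_eq_zero_or_one (Sum.inr h, a) e
  constructor
  · exact integral_nonneg fun e => by rcases h01 e with h | h <;> simp [h]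
  · refine (integral_mono (Tree.integrable_law _ _) (integrable_const 1) fun e => ?_).trans_eq
      (by simp)
    rcases h01 e with h | h <;> simp [h]

include hG hs hF hh ha in
theorem integral_target_epsGreedy (Q : Table I₀ I₁ A) (V : I₀ ⊕ I₁ → ℝ) (x : ℝ) :
    ∫ e, ((movesAfter (.inr h, a) (moves₁ e)).elim 0 fun l =>
        nextTarget V (-G.root.outcome e) l - x) ∂(G.root.law (epsGreedy g ε hε1 Q)).toMeasure
      = visitProb g ε hε1 s seq Q h a *
        (G.bellman (pureStrategy s) (fun k => V (.inr k)) h a - x) := by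
  rw [hF.law_eq (epsGreedy_respects g hε1 Q)]
  exact Game.integral_target_sub hG (M.respects_pureStrategy hs)
    (fun k b hb => epsGreedy_respects g hε1 Q (.inr k) b hb) ha V x hh

include hG hs hF hh ha in
-- One expected update is an averaging step towards the Bellman value of the present table. The zero
-- visit counts in `meanUpdate` do not matter, as the step size is constant.
theorem meanUpdate_eq (c : ℝ) (Q : Table I₀ I₁ A) :
    meanUpdate g ε hε1 c Q (.inr h) a
      = (1 - c * visitProb g ε hε1 s seq Q h a) * Q (.inr h) a
        + c * visitProb g ε hε1 s seq Q h a *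
          G.bellman (pureStrategy s) (fun k => M.tableMax Q (.inr k)) h a := by
  have h1 : meanUpdate g ε hε1 c Q (.inr h) a
      = ∫ e, (Q (.inr h) a + c * (movesAfter (.inr h, a) (moves₁ e)).elim 0 fun l' =>
          nextTarget (M.tableMax Q) (-G.root.outcome e) l' - Q (.inr h) a)
        ∂(G.root.law (epsGreedy g ε hε1 Q)).toMeasure :=
    integral_congr_ae (PMF.ae_of_support fun e he => Memory.afterEpisode_Q M _ _
      (nodup_of_mem_support_epsGreedy g hε1 hG Q he) h a)
  rw [h1, integral_add (integrable_const _) (Tree.integrable_law _ _), integral_const_mul,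
    integral_target_epsGreedy g hε1 hG hs hF hh ha, integral_const, probReal_univ, one_smul]
  ring

end Exploring

/-! ### Convergence of tables -/

section Tables

variable [Fintype A] [Fintype I₁] [DecidableEq I₁] [DecidableEq A]
  {G : Game I₀ I₁ A} {M : Mask G} {σ : I₀ → PMF A} {seq : I₁ → List (I₁ × A)}
  (hG : G.root.Recalls G seq []) (hσ : Respects (fun k => G.legal (.inl k)) σ)
  {V : I₁ → ℝ} (hV : G.IsOptimal σ V)
include hG hσ hV

/-- Backward induction replaces a contraction argument: the Bellman value at `h` reads only
information sets one level deeper, whose Q-values already converge, so the averaging target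
converges. -/
theorem Game.IsOptimal.tendsto_tables {Q : ℕ → Table I₀ I₁ A}
    (hQ : ∀ h, G.Reachable₁ σ h → ∀ a ∈ G.legal₁ h, ∃ (w z : ℕ → ℝ) (Z : ℝ),
      (∀ n, w n ∈ Set.Icc (0 : ℝ) 1) ∧
      Tendsto (fun n => ∑ i ∈ Finset.range n, w i) atTop atTop ∧
      Tendsto (fun n => ∑ i ∈ Finset.range n, z i) atTop (𝓝 Z) ∧
      ∀ n, Q (n + 1) (.inr h) a = (1 - w n) * Q n (.inr h) a
        + w n * G.bellman σ (fun k => M.tableMax (Q n) (.inr k)) h a + z n)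
    (h : I₁) (hh : G.Reachable₁ σ h) (a : A) (ha : a ∈ G.legal₁ h) :
    Tendsto (fun n => Q n (.inr h) a) atTop (𝓝 (G.bellman σ V h a)) := by
  revert a
  revert hh
  refine forall_of_forall_next (seq := seq) (P := fun h => G.Reachable₁ σ h → ∀ a ∈ G.legal₁ h,
    Tendsto (fun n => Q n (.inr h) a) atTop (𝓝 (G.bellman σ V h a))) (fun h ih hh a ha => ?_) h
  obtain ⟨w, z, Z, hw, hws, hz, hrec⟩ := hQ h hh a ha
  refine tendsto_of_noisy_averaging hrec hw hws ?_ hz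
  refine Game.tendsto_bellman hG hσ ha fun k hk hr => ?_
  rw [hV k hr]
  exact Game.tendsto_maxVal (q := fun n h => Q n (.inr h)) fun b hb => ih k hk hr b hb

end Tables

section MeanUpdate

variable [Fintype A] [Fintype I₁] [DecidableEq I₀] [DecidableEq I₁] [DecidableEq A]
  {G : Game I₀ I₁ A} {M : Mask G} {s : I₀ → A} {seq : I₁ → List (I₁ × A)}
  (g : GreedyRule M) {ε : ℝ≥0} (hε1 : ε ≤ 1)
  (hG : G.root.Recalls G seq []) (hs : ∀ h, s h ∈ M.keep h) (hF : G.root.Forced M s)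
  {V : I₁ → ℝ} (hV : G.IsOptimal (pureStrategy s) V) {c : ℝ} (hc : c ∈ Set.Ioo (0 : ℝ) 1)
include hG hs hF hV hc

theorem abs_meanUpdate_sub_le {δ : ℝ} {Q : Table I₀ I₁ A}
    (hQ : ∀ h, G.Reachable₁ (pureStrategy s) h → ∀ a ∈ G.legal₁ h,
      |Q (.inr h) a - G.bellman (pureStrategy s) V h a| ≤ δ)
    {h : I₁} (hh : G.Reachable₁ (pureStrategy s) h) {a : A} (ha : a ∈ G.legal₁ h) :
    |meanUpdate g ε hε1 c Q (.inr h) a - G.bellman (pureStrategy s) V h a| ≤ δ := by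
  have hδ : 0 ≤ δ := (abs_nonneg _).trans (hQ h hh a ha)
  obtain ⟨p0, p1⟩ := visitProb_mem_Icc g hε1 hG hs hF ha Q
  rw [meanUpdate_eq g hε1 hG hs hF hh ha]
  set β := c * visitProb g ε hε1 s seq Q h a with hβ
  have hβ0 : 0 ≤ β := mul_nonneg hc.1.le p0
  have hβ1 : β ≤ 1 := mul_le_one₀ hc.2.le p0 p1
  have h1 : |G.bellman (pureStrategy s) (fun k => M.tableMax Q (.inr k)) h a
      - G.bellman (pureStrategy s) V h a| ≤ δ :=
    Game.abs_bellman_sub_le hG (M.respects_pureStrategy hs) hδ ha hh fun k hr => by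
      rw [hV k hr]
      exact Game.abs_maxVal_sub_le (q := fun h => Q (.inr h)) fun b hb => hQ k hr b hb
  have h2 := abs_le.1 h1
  have h3 := abs_le.1 (hQ h hh a ha)
  rw [abs_le]
  constructor <;> nlinarith [h2.1, h2.2, h3.1, h3.2]

theorem abs_iterate_meanUpdate_sub_le {δ : ℝ} {Q : Table I₀ I₁ A}
    (hQ : ∀ h, G.Reachable₁ (pureStrategy s) h → ∀ a ∈ G.legal₁ h,
      |Q (.inr h) a - G.bellman (pureStrategy s) V h a| ≤ δ) (n : ℕ)
    (h : I₁) (hh : G.Reachable₁ (pureStrategy s) h) (a : A) (ha : a ∈ G.legal₁ h) :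
    |(meanUpdate g ε hε1 c)^[n] Q (.inr h) a - G.bellman (pureStrategy s) V h a| ≤ δ := by
  induction n generalizing h a with
  | zero => exact hQ h hh a ha
  | succ n ih =>
    rw [Function.iterate_succ_apply']
    exact abs_meanUpdate_sub_le g hε1 hG hs hF hV hc ih hh ha

theorem tendsto_iterate_meanUpdate (hε0 : 0 < ε) (Q : Table I₀ I₁ A)
    (h : I₁) (hh : G.Reachable₁ (pureStrategy s) h) (a : A) (ha : a ∈ G.legal₁ h) :
    Tendsto (fun n => (meanUpdate g ε hε1 c)^[n] Q (.inr h) a) atTop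
      (𝓝 (G.bellman (pureStrategy s) V h a)) := by
  refine hV.tendsto_tables (M := M) (Q := fun n => (meanUpdate g ε hε1 c)^[n] Q) hG
    (M.respects_pureStrategy hs) (fun h hh a ha => ?_) h hh a ha
  obtain ⟨δ, hδ, hle⟩ := exists_le_visitProb g hε1 hG hs hh ha hε0
  refine ⟨fun n => c * visitProb g ε hε1 s seq ((meanUpdate g ε hε1 c)^[n] Q) h a, fun _ => 0, 0,
    fun n => ?_, ?_, by simp, fun n => ?_⟩
  · obtain ⟨p0, p1⟩ := visitProb_mem_Icc g hε1 hG hs hF ha ((meanUpdate g ε hε1 c)^[n] Q)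
    exact ⟨mul_nonneg hc.1.le p0, mul_le_one₀ hc.2.le p0 p1⟩
  · refine tendsto_atTop_mono (fun n => ?_)
      (tendsto_natCast_atTop_atTop.atTop_mul_const (mul_pos hc.1 hδ))
    rw [← nsmul_eq_mul]
    refine (Finset.card_nsmul_le_sum (Finset.range n) _ _ fun i _ =>
      mul_le_mul_of_nonneg_left (hle _) hc.1.le).trans' (by simp)
  · rw [add_zero, Function.iterate_succ_apply', meanUpdate_eq g hε1 hG hs hF hh ha]

end MeanUpdate

/-- An action strictly worse in the limit is eventually strictly worse. There are finitely many
comparisons, so one late time serves for all `τ`. -/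
theorem Game.eventually_isGreedyStrategy [Fintype I₁] [DecidableEq I₁] [Fintype A]
    {G : Game I₀ I₁ A} {σ : I₀ → PMF A}
    {q : ℕ → I₁ → A → ℝ} {q' : I₁ → A → ℝ}
    (hq : ∀ h, G.Reachable₁ σ h → ∀ a ∈ G.legal₁ h, Tendsto (fun t => q t h a) atTop (𝓝 (q' h a))) :
    ∀ᶠ t in atTop, ∀ τ, G.IsGreedyStrategy σ (q t) τ → G.IsGreedyStrategy σ q' τ := by
  have key : ∀ᶠ t in atTop, ∀ h a b, G.Reachable₁ σ h → a ∈ G.legal₁ h → b ∈ G.legal₁ h →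
      q t h b ≤ q t h a → q' h b ≤ q' h a := by
    simp only [eventually_all]
    intro h a b hh ha hb
    by_cases hab : q' h b ≤ q' h a
    · exact Eventually.of_forall fun _ _ => hab
    · filter_upwards [(hq h hh a ha).eventually_lt (hq h hh b hb) (not_le.1 hab)] with t ht h'
      exact absurd h' (not_le.2 ht)
  filter_upwards [key] with t ht τ hτ
  exact ⟨hτ.1, fun h hh a ha b hb =>
    ht h a b hh (hτ.1 h a ha) hb (hτ.2 h hh a ha b hb)⟩

/-! ### The training run as a chain -/

section Training

variable [DecidableEq I₀] [DecidableEq I₁] [DecidableEq A] {G : Game I₀ I₁ A}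

theorem memoryAt_congr (M : Mask G) (α : ℕ → ℝ) (Q₀ : Table I₀ I₁ A) {ω ω' : ℕ → Episode I₀ I₁ A}
    {t : ℕ} (h : ∀ i < t, ω i = ω' i) : memoryAt M α Q₀ ω t = memoryAt M α Q₀ ω' t := by
  induction t with
  | zero => rfl
  | succ t ih =>
    rw [memoryAt, memoryAt, ih fun i hi => h i (by omega), h t (by omega)]

theorem exists_abs_memoryAt_le [Finite I₀] [Finite I₁] [Finite A] (M : Mask G) {α : ℕ → ℝ}
    (hα : ∀ n, α n ∈ Set.Ioo (0 : ℝ) 1) (Q₀ : Table I₀ I₁ A) :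
    ∃ C, (∀ e, |G.root.outcome e| ≤ C) ∧ ∀ ω t h a, |(memoryAt M α Q₀ ω t).Q h a| ≤ C := by
  have := Fintype.ofFinite A
  obtain ⟨C₁, hC₁⟩ := Tree.exists_abs_outcome_le G.root
  obtain ⟨C₂, hC₂⟩ := (Set.finite_range fun x : (I₀ ⊕ I₁) × A => |Q₀ x.1 x.2|).bddAbove
  have h1 : ∀ e, |G.root.outcome e| ≤ max C₁ C₂ := fun e => (hC₁ e).trans (le_max_left _ _)
  refine ⟨max C₁ C₂, h1, fun ω t => ?_⟩
  induction t with
  | zero => exact fun h a => (hC₂ ⟨(h, a), rfl⟩).trans (le_max_right _ _)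
  | succ t ih => exact fun h a => Memory.afterEpisode_abs_le M α hα h1 _ ih _ h a

theorem visit_le_visits (M : Mask G) (α : ℕ → ℝ) (Q₀ : Table I₀ I₁ A) (h : I₁) (a : A)
    (ω : ℕ → Episode I₀ I₁ A) (t : ℕ) :
    (memoryAt M α Q₀ ω t).visits (.inr h) a + visit (.inr h, a) (ω t)
      ≤ (memoryAt M α Q₀ ω (t + 1)).visits (.inr h) a := by
  rw [memoryAt, Memory.afterEpisode_visits, Nat.cast_add]
  exact add_le_add le_rfl (elim_movesAfter_le_countP _ _)

theorem sum_visit_le_visits (M : Mask G) (α : ℕ → ℝ) (Q₀ : Table I₀ I₁ A) (h : I₁) (a : A)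
    (ω : ℕ → Episode I₀ I₁ A) (n : ℕ) :
    ∑ i ∈ Finset.range n, visit (.inr h, a) (ω (i + 1))
      ≤ (memoryAt M α Q₀ ω (n + 1)).visits (.inr h) a := by
  induction n with
  | zero => simp
  | succ n ih =>
    rw [Finset.sum_range_succ]
    have := visit_le_visits M α Q₀ h a ω (n + 1)
    linarith

/-- Distinct visits use distinct members of the sequence `α`, so the squared steps are among the
squares of its first members. -/
theorem sum_sq_step_le (M : Mask G) (α : ℕ → ℝ) (Q₀ : Table I₀ I₁ A) (h : I₁) (a : A)
    (ω : ℕ → Episode I₀ I₁ A) (n : ℕ) :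
    ∑ i ∈ Finset.range n, (α ((memoryAt M α Q₀ ω (i + 1)).visits (.inr h) a)
        * visit (.inr h, a) (ω (i + 1))) ^ 2
      ≤ ∑ j ∈ Finset.range ((memoryAt M α Q₀ ω (n + 1)).visits (.inr h) a), α j ^ 2 := by
  induction n with
  | zero => simpa using Finset.sum_nonneg fun j _ => sq_nonneg (α j)
  | succ n ih =>
    rw [Finset.sum_range_succ]
    have hv := visit_le_visits M α Q₀ h a ω (n + 1)
    rcases visit_eq_zero_or_one (Sum.inr h, a) (ω (n + 1)) with h0 | h1
    · rw [h0, add_zero, Nat.cast_le] at hv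
      rw [h0, mul_zero, zero_pow two_ne_zero, add_zero]
      exact ih.trans (Finset.sum_le_sum_of_subset_of_nonneg (Finset.range_mono hv)
        fun j _ _ => sq_nonneg _)
    · rw [h1] at hv ⊢
      rw [mul_one]
      have hv' : (memoryAt M α Q₀ ω (n + 1)).visits (.inr h) a + 1
          ≤ (memoryAt M α Q₀ ω (n + 1 + 1)).visits (.inr h) a := by exact_mod_cast hv
      refine (add_le_add ih le_rfl).trans ?_
      rw [← Finset.sum_range_succ]
      exact Finset.sum_le_sum_of_subset_of_nonneg (Finset.range_mono hv') fun j _ _ => sq_nonneg _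

/-- With at most one visit per episode the steps run through `α` without gaps. The subtracted sum
accounts for episode `0`, which the transition kernels do not cover. -/
theorem sum_step_eq (M : Mask G) (α : ℕ → ℝ) (Q₀ : Table I₀ I₁ A) (h : I₁) (a : A)
    {ω : ℕ → Episode I₀ I₁ A} (hω : ∀ t, ((moves₁ (ω (t + 1))).map Prod.fst).Nodup) (n : ℕ) :
    ∑ i ∈ Finset.range n, α ((memoryAt M α Q₀ ω (i + 1)).visits (.inr h) a)
        * visit (.inr h, a) (ω (i + 1))
      = ∑ j ∈ Finset.range ((memoryAt M α Q₀ ω (n + 1)).visits (.inr h) a), α j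
        - ∑ j ∈ Finset.range ((memoryAt M α Q₀ ω 1).visits (.inr h) a), α j := by
  induction n with
  | zero => simp
  | succ n ih =>
    have hv : ((memoryAt M α Q₀ ω (n + 1 + 1)).visits (.inr h) a : ℝ)
        = (memoryAt M α Q₀ ω (n + 1)).visits (.inr h) a + visit (.inr h, a) (ω (n + 1)) := by
      rw [memoryAt, Memory.afterEpisode_visits, Nat.cast_add, visit,
        elim_movesAfter_eq_countP _ (List.Nodup.of_map _ (hω n))]
    rw [Finset.sum_range_succ, ih]
    rcases visit_eq_zero_or_one (Sum.inr h, a) (ω (n + 1)) with h0 | h1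
    · rw [h0, add_zero, Nat.cast_inj] at hv
      rw [h0, hv, mul_zero, add_zero]
    · rw [h1] at hv ⊢
      have hv' : (memoryAt M α Q₀ ω (n + 1 + 1)).visits (.inr h) a
          = (memoryAt M α Q₀ ω (n + 1)).visits (.inr h) a + 1 := by exact_mod_cast hv
      rw [hv', Finset.sum_range_succ]
      ring

section Law

variable [Countable I₀] [Countable I₁] [Countable A] {M : Mask G}
  (g : GreedyRule M) {ε : ℝ≥0} (hε1 : ε ≤ 1) (α : ℕ → ℝ) (Q₀ : Table I₀ I₁ A)

instance : IsProbabilityMeasure (trainingLaw g ε hε1 α Q₀) := by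
  have : IsProbabilityMeasure (((G.root.law (epsGreedy g ε hε1 Q₀)).toMeasure).map
      (fun e (_ : Finset.Iic 0) => e)) :=
    Measure.isProbabilityMeasure_map Measurable.of_discrete.aemeasurable
  rw [trainingLaw]
  infer_instance

/-- Both sides are mixtures over the first episode; for a fixed one this is the defining property of
the Ionescu-Tulcea measure `Kernel.traj`. -/
theorem hasTransitions_trainingLaw :
    HasTransitions (trainingLaw g ε hε1 α Q₀) (nextEpisode g ε hε1 α Q₀) := by
  intro t
  have : IsProbabilityMeasure (((G.root.law (epsGreedy g ε hε1 Q₀)).toMeasure).map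
      (fun e (_ : Finset.Iic 0) => e)) :=
    Measure.isProbabilityMeasure_map Measurable.of_discrete.aemeasurable
  rw [Measure.compProd_eq_comp_prod, trainingLaw, Measure.map_comp _ _ (by fun_prop),
    Kernel.traj_map_frestrictLe, Measure.comp_assoc, Measure.map_comp _ _ (by fun_prop)]
  congr with x₀ : 1
  rw [Kernel.comp_apply, ← Measure.compProd_eq_comp_prod, Kernel.map_apply _ (by fun_prop),
    Kernel.partialTraj_compProd_eq_map_traj (Nat.zero_le t)]

theorem nextEpisode_frestrictLe (t : ℕ) (ω : ℕ → Episode I₀ I₁ A) :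
    nextEpisode g ε hε1 α Q₀ t (Preorder.frestrictLe t ω)
      = (G.root.law (epsGreedy g ε hε1 (memoryAt M α Q₀ ω (t + 1)).Q)).toMeasure := by
  have : memoryAt M α Q₀ (extend (Preorder.frestrictLe t ω)) (t + 1)
      = memoryAt M α Q₀ ω (t + 1) :=
    memoryAt_congr M α Q₀ fun i hi => by simp [extend, Nat.lt_succ_iff.1 hi]
  change (G.root.law (playAt g ε hε1 α Q₀ (extend (Preorder.frestrictLe t ω)) (t + 1))).toMeasure
    = _
  rw [playAt, this]

theorem ae_nodup_moves₁ {seq : I₁ → List (I₁ × A)} (hG : G.root.Recalls G seq []) :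
    ∀ᵐ ω ∂(trainingLaw g ε hε1 α Q₀), ∀ t, ((moves₁ (ω (t + 1))).map Prod.fst).Nodup := by
  refine ae_all_iff.2 fun t => ?_
  -- The indicator of the bad event has conditional expectation zero given the past, and it is
  -- nonnegative.
  set f : (ℕ → Episode I₀ I₁ A) → ℝ := fun ω =>
    if ((moves₁ (ω (t + 1))).map Prod.fst).Nodup then 0 else 1 with hf
  have hdep : DependsOn f (Set.Iic (t + 1)) := fun x y hxy => by
    simp only [hf, hxy (t + 1) (Set.mem_Iic.2 le_rfl)]
  have hb : ∀ ω, |f ω| ≤ 1 := fun ω => by simp only [hf]; split_ifs <;> simp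
  have h0 : ∫ ω, f ω ∂(trainingLaw g ε hε1 α Q₀) = 0 := by
    refine (hasTransitions_trainingLaw g hε1 α Q₀).integral_eq_zero hdep hb fun ω => ?_
    rw [nextEpisode_frestrictLe]
    refine integral_eq_zero_of_ae (PMF.ae_of_support fun e he => ?_)
    have := nodup_of_mem_support_epsGreedy g hε1 hG _ he
    simp [hf, this]
  rw [integral_eq_zero_iff_of_nonneg (fun ω => by simp only [hf]; split_ifs <;> simp)
    (integrable_of_dependsOn hdep hb)] at h0
  filter_upwards [h0] with ω hω
  by_contra hn
  simp [hf, hn] at hω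

end Law

section Convergence

variable [Fintype I₀] [Fintype I₁] [Fintype A] {M : Mask G} {s : I₀ → A}
  {seq : I₁ → List (I₁ × A)} (g : GreedyRule M) {ε : ℝ≥0} (hε1 : ε ≤ 1) {α : ℕ → ℝ}
  (Q₀ : Table I₀ I₁ A)
  (hG : G.root.Recalls G seq []) (hs : ∀ h, s h ∈ M.keep h) (hF : G.root.Forced M s)
  {h : I₁} (hh : G.Reachable₁ (pureStrategy s) h) {a : A} (ha : a ∈ G.legal₁ h)

include hG hs hF hh ha in
-- A conditional Borel-Cantelli argument: weights `1 / (n + 1)` make the centred visits a convergent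
-- martingale, being square summable, while the compensator is at least `δ` times the divergent
-- harmonic series.
theorem ae_tendsto_visits (hε0 : 0 < ε) :
    ∀ᵐ ω ∂(trainingLaw g ε hε1 α Q₀),
      Tendsto (fun n => (memoryAt M α Q₀ ω (n + 1)).visits (.inr h) a) atTop atTop := by
  set p : ℕ → (ℕ → Episode I₀ I₁ A) → ℝ := fun n ω =>
    visitProb g ε hε1 s seq (memoryAt M α Q₀ ω (n + 1)).Q h a with hp
  set D : ℕ → (ℕ → Episode I₀ I₁ A) → ℝ := fun n ω =>
    (visit (.inr h, a) (ω (n + 1)) - p n ω) * (1 / ((n : ℝ) + 1)) with hD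
  have hp01 : ∀ n ω, p n ω ∈ Set.Icc (0 : ℝ) 1 := fun n ω => visitProb_mem_Icc g hε1 hG hs hF ha _
  have hdep : ∀ n, DependsOn (D n) (Set.Iic (n + 1)) := fun n x y hxy => by
    simp only [hD, hp]
    rw [hxy (n + 1) (Set.mem_Iic.2 le_rfl),
      memoryAt_congr M α Q₀ fun i hi => hxy i (Set.mem_Iic.2 (le_of_lt hi))]
  have hsummable : Summable fun n : ℕ => (1 / ((n : ℝ) + 1)) ^ 2 := by
    have := (summable_nat_add_iff 1).2 (Real.summable_one_div_nat_pow.2 one_lt_two)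
    simpa using this
  obtain ⟨δ, hδ, hle⟩ := exists_le_visitProb g hε1 hG hs hh ha hε0
  have hconv := (hasTransitions_trainingLaw g hε1 α Q₀).ae_exists_tendsto_sum (D := D) hdep
    (fun n ω => ?_) (C := ∑' n : ℕ, (1 / ((n : ℝ) + 1)) ^ 2) fun n ω => ?_
  · filter_upwards [hconv] with ω ⟨c, hc⟩
    have hdiv : Tendsto (fun n => ∑ i ∈ Finset.range n, D i ω
        + δ * ∑ i ∈ Finset.range n, 1 / ((i : ℝ) + 1)) atTop atTop :=
      hc.add_atTop (Real.tendsto_sum_range_one_div_nat_succ_atTop.const_mul_atTop hδ)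
    refine (tendsto_natCast_atTop_iff (R := ℝ)).1 (tendsto_atTop_mono (fun n => ?_) hdiv)
    refine le_trans ?_ (sum_visit_le_visits M α Q₀ h a ω n)
    rw [Finset.mul_sum, ← Finset.sum_add_distrib]
    refine Finset.sum_le_sum fun i _ => ?_
    have h1 : δ ≤ p i ω := hle _
    have h2 : 0 ≤ 1 / ((i : ℝ) + 1) := by positivity
    have h3 : 1 / ((i : ℝ) + 1) ≤ 1 := by
      rw [div_le_one (by positivity)]
      linarith [(Nat.cast_nonneg i : (0 : ℝ) ≤ i)]
    have h4 : 0 ≤ visit (Sum.inr h, a) (ω (i + 1)) := by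
      rcases visit_eq_zero_or_one (Sum.inr h, a) (ω (i + 1)) with h | h <;> simp [h]
    simp only [hD]
    nlinarith [mul_le_mul_of_nonneg_right h1 h2, mul_le_mul_of_nonneg_left h3 h4]
  · rw [nextEpisode_frestrictLe]
    have hm : ∀ e, memoryAt M α Q₀ (Function.update ω (n + 1) e) (n + 1)
        = memoryAt M α Q₀ ω (n + 1) := fun e =>
      memoryAt_congr M α Q₀ fun i hi => Function.update_of_ne (ne_of_lt hi) _ _
    simp only [hD, hp, hm, Function.update_self]
    rw [integral_mul_const, integral_sub (Tree.integrable_law _ _) (integrable_const _),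
      integral_visit_epsGreedy g hε1 hG hs hF ha]
    simp
  · refine (Finset.sum_le_sum fun i _ => ?_).trans
      (hsummable.sum_le_tsum (Finset.range n) fun i _ => sq_nonneg _)
    simp only [hD]
    rw [mul_pow]
    refine mul_le_of_le_one_left (sq_nonneg _) ?_
    obtain ⟨p0, p1⟩ := hp01 i ω
    rw [sq_le_one_iff_abs_le_one, abs_le]
    rcases visit_eq_zero_or_one (Sum.inr h, a) (ω (i + 1)) with h | h <;> rw [h] <;>
      constructor <;> linarith

include hG hs hF hh ha in
theorem ae_exists_recursion (hε0 : 0 < ε) (hα : ∀ n, α n ∈ Set.Ioo (0 : ℝ) 1)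
    (hRM : RobbinsMonro α) :
    ∀ᵐ ω ∂(trainingLaw g ε hε1 α Q₀), ∃ (w z : ℕ → ℝ) (Z : ℝ),
      (∀ n, w n ∈ Set.Icc (0 : ℝ) 1) ∧
      Tendsto (fun n => ∑ i ∈ Finset.range n, w i) atTop atTop ∧
      Tendsto (fun n => ∑ i ∈ Finset.range n, z i) atTop (𝓝 Z) ∧
      ∀ n, (memoryAt M α Q₀ ω (n + 1 + 1)).Q (.inr h) a
        = (1 - w n) * (memoryAt M α Q₀ ω (n + 1)).Q (.inr h) a
          + w n * G.bellman (pureStrategy s)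
            (fun k => M.tableMax (memoryAt M α Q₀ ω (n + 1)).Q (.inr k)) h a + z n := by
  obtain ⟨C, hCo, hCQ⟩ := exists_abs_memoryAt_le M hα Q₀
  set b : ℕ → (ℕ → Episode I₀ I₁ A) → ℝ := fun n ω => G.bellman (pureStrategy s)
    (fun k => M.tableMax (memoryAt M α Q₀ ω (n + 1)).Q (.inr k)) h a with hb
  set w : ℕ → (ℕ → Episode I₀ I₁ A) → ℝ := fun n ω =>
    α ((memoryAt M α Q₀ ω (n + 1)).visits (.inr h) a) * visit (.inr h, a) (ω (n + 1)) with hw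
  -- The noise is the target minus its conditional mean `b`, present only on a visit. It is thus at
  -- most a constant times the step `w`, and its squares are summable with a bound valid on every
  -- run.
  set D : ℕ → (ℕ → Episode I₀ I₁ A) → ℝ := fun n ω =>
    α ((memoryAt M α Q₀ ω (n + 1)).visits (.inr h) a) *
      (movesAfter (.inr h, a) (moves₁ (ω (n + 1)))).elim 0 fun l =>
        nextTarget (M.tableMax (memoryAt M α Q₀ ω (n + 1)).Q) (-G.root.outcome (ω (n + 1))) l
          - b n ω with hD
  have hC0 : 0 ≤ C := (abs_nonneg _).trans (hCo [])
  set B : ℝ := |G.bellman (pureStrategy s) (fun _ => 0) h a| + C with hB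
  have hbB : ∀ n ω, |b n ω| ≤ B := fun n ω => by
    have := Game.abs_bellman_sub_le hG (M.respects_pureStrategy hs) hC0 ha hh
      (V := fun k => M.tableMax (memoryAt M α Q₀ ω (n + 1)).Q (.inr k)) (V' := fun _ => 0)
      fun k _ => by rw [sub_zero]; exact M.abs_tableMax_le (hCQ ω (n + 1)) _
    have h2 := abs_sub_abs_le_abs_sub (b n ω) (G.bellman (pureStrategy s) (fun _ => 0) h a)
    simp only [hb] at h2 ⊢
    rw [hB]
    linarith
  have hdep : ∀ n, DependsOn (D n) (Set.Iic (n + 1)) := fun n x y hxy => by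
    simp only [hD, hb]
    rw [hxy (n + 1) (Set.mem_Iic.2 le_rfl),
      memoryAt_congr M α Q₀ fun i hi => hxy i (Set.mem_Iic.2 (le_of_lt hi))]
  have hDw : ∀ n ω, D n ω ^ 2 ≤ (C + B) ^ 2 * w n ω ^ 2 := fun n ω => by
    simp only [hD, hw, visit]
    cases movesAfter (Sum.inr h, a) (moves₁ (ω (n + 1))) with
    | none => simp
    | some l =>
      simp only [Option.elim_some, mul_one]
      rw [mul_pow, mul_comm]
      refine mul_le_mul_of_nonneg_right ?_ (sq_nonneg _)
      rw [← sq_abs]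
      refine pow_le_pow_left₀ (abs_nonneg _) ((abs_sub _ _).trans (add_le_add ?_ (hbB n ω))) 2
      exact abs_nextTarget_le (fun k => M.abs_tableMax_le (hCQ ω (n + 1)) k)
        (by rw [abs_neg]; exact hCo _) l
  have hconv := (hasTransitions_trainingLaw g hε1 α Q₀).ae_exists_tendsto_sum (D := D) hdep
    (fun n ω => ?_) (C := (C + B) ^ 2 * ∑' n, α n ^ 2) fun n ω => ?_
  · filter_upwards [hconv, ae_nodup_moves₁ g hε1 α Q₀ hG,
      ae_tendsto_visits g hε1 Q₀ hG hs hF hh ha hε0] with ω ⟨Z, hZ⟩ hnd hv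
    refine ⟨fun n => w n ω, fun n => D n ω, Z, fun n => ?_, ?_, hZ, fun n => ?_⟩
    · have h1 := hα ((memoryAt M α Q₀ ω (n + 1)).visits (.inr h) a)
      simp only [hw]
      rcases visit_eq_zero_or_one (Sum.inr h, a) (ω (n + 1)) with h0 | h0 <;> rw [h0]
      · simp
      · rw [mul_one]; exact ⟨h1.1.le, h1.2.le⟩
    · simp only [hw]
      simp_rw [sum_step_eq M α Q₀ h a hnd]
      exact tendsto_atTop_add_const_right _ _ (hRM.1.comp hv)
    · rw [memoryAt, Memory.afterEpisode_Q M α _ (hnd n)]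
      simp only [hw, hD, hb, visit]
      cases movesAfter (Sum.inr h, a) (moves₁ (ω (n + 1))) with
      | none => simp
      | some l => simp only [Option.elim_some]; ring
  · rw [nextEpisode_frestrictLe]
    have hm : ∀ e, memoryAt M α Q₀ (Function.update ω (n + 1) e) (n + 1)
        = memoryAt M α Q₀ ω (n + 1) := fun e =>
      memoryAt_congr M α Q₀ fun i hi => Function.update_of_ne (ne_of_lt hi) _ _
    simp only [hD, hb, hm, Function.update_self]
    -- The step size and the table are known before the episode; with the Bellman value as the
    -- reference point the conditional mean vanishes.
    rw [integral_const_mul, integral_target_epsGreedy g hε1 hG hs hF hh ha, sub_self, mul_zero,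
      mul_zero]
  · calc ∑ t ∈ Finset.range n, D t ω ^ 2
        ≤ ∑ t ∈ Finset.range n, (C + B) ^ 2 * w t ω ^ 2 := Finset.sum_le_sum fun t _ => hDw t ω
      _ = (C + B) ^ 2 * ∑ t ∈ Finset.range n, w t ω ^ 2 := by rw [Finset.mul_sum]
      _ ≤ _ := mul_le_mul_of_nonneg_left ((sum_sq_step_le M α Q₀ h a ω n).trans
          (hRM.2.sum_le_tsum _ fun i _ => sq_nonneg _)) (sq_nonneg _)

include hG hs hF in
theorem ae_tendsto_memoryAt (hε0 : 0 < ε) (hα : ∀ n, α n ∈ Set.Ioo (0 : ℝ) 1)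
    (hRM : RobbinsMonro α) {V : I₁ → ℝ} (hV : G.IsOptimal (pureStrategy s) V) :
    ∀ᵐ ω ∂(trainingLaw g ε hε1 α Q₀), ∀ h, G.Reachable₁ (pureStrategy s) h → ∀ a ∈ G.legal₁ h,
      Tendsto (fun t => (memoryAt M α Q₀ ω t).Q (.inr h) a) atTop
        (𝓝 (G.bellman (pureStrategy s) V h a)) := by
  have hrec : ∀ᵐ ω ∂(trainingLaw g ε hε1 α Q₀), ∀ h, G.Reachable₁ (pureStrategy s) h →
      ∀ a ∈ G.legal₁ h, ∃ (w z : ℕ → ℝ) (Z : ℝ),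
      (∀ n, w n ∈ Set.Icc (0 : ℝ) 1) ∧
      Tendsto (fun n => ∑ i ∈ Finset.range n, w i) atTop atTop ∧
      Tendsto (fun n => ∑ i ∈ Finset.range n, z i) atTop (𝓝 Z) ∧
      ∀ n, (memoryAt M α Q₀ ω (n + 1 + 1)).Q (.inr h) a
        = (1 - w n) * (memoryAt M α Q₀ ω (n + 1)).Q (.inr h) a
          + w n * G.bellman (pureStrategy s)
            (fun k => M.tableMax (memoryAt M α Q₀ ω (n + 1)).Q (.inr k)) h a + z n := by
    simp only [ae_all_iff, eventually_imp_distrib_left]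
    exact fun h hh a ha => ae_exists_recursion g hε1 Q₀ hG hs hF hh ha hε0 hα hRM
  filter_upwards [hrec] with ω hω h hh a ha
  -- The recursion starts after episode `0`, which a limit does not see.
  rw [← tendsto_add_atTop_iff_nat 1]
  exact hV.tendsto_tables (M := M) (Q := fun n => (memoryAt M α Q₀ ω (n + 1)).Q) hG
    (M.respects_pureStrategy hs) hω h hh a ha

end Convergence

end Training

end

end MaskedSelfPlay

/-! ### Assembly of the proposition -/

open MaskedSelfPlay in
theorem proposition1 {I₀ I₁ A : Type*} [Fintype I₀] [Fintype I₁] [Fintype A]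
    [DecidableEq I₀] [DecidableEq I₁] [DecidableEq A]
    (G : Game I₀ I₁ A) (hrecall : G.PerfectRecall₁) (M : Mask G)
    (g : GreedyRule M) (ε : ℝ≥0) (hε0 : 0 < ε) (hε1 : ε ≤ 1)
    (α : ℕ → ℝ) (hα : ∀ n, α n ∈ Set.Ioo (0 : ℝ) 1)
    (Q₀ : Table I₀ I₁ A)
    (hCAC : M.CACw (epsGreedy g ε hε1 Q₀) = 0)
    (s : I₀ → A) (hs : ∀ h, s h ∈ M.keep h) :
    -- (i) along every run, the victim's policy converges to the unique forced action
    ((∀ (ω : ℕ → Episode I₀ I₁ A) (t : ℕ) (h : I₀),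
        0 < G.reachProb (playAt g ε hε1 α Q₀ ω t) (Sum.inl h) → M.keep h = {s h}) ∧
      (∀ (ω : ℕ → Episode I₀ I₁ A) (h : I₀), M.keep h = {s h} → ∀ a : A,
        Tendsto (fun t => playAt g ε hε1 α Q₀ ω t (Sum.inl h) a) atTop
          (𝓝 (pureStrategy s h a)))) ∧
    -- there is a best response to the forced strategy
    (∃ τ, G.IsBestResponse (pureStrategy s) τ) ∧
    ∀ τ, G.IsBestResponse (pureStrategy s) τ →
      -- (ii) convergence of the opponent's Q-values to those of a best response
      (RobbinsMonro α →
        ∀ᵐ ω ∂(trainingLaw g ε hε1 α Q₀), ∀ h, G.Reachable₁ (pureStrategy s) h →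
          ∀ a ∈ G.legal₁ h,
            Tendsto (fun t => (memoryAt M α Q₀ ω t).Q (Sum.inr h) a) atTop
              (𝓝 (G.actionValue (pureStrategy s) τ h a))) ∧
      -- (iii) in the masked game no player gains by a unilateral deviation
      ((∀ σ', Respects M.keep σ' → G.payoff₀ σ' τ ≤ G.payoff₀ (pureStrategy s) τ) ∧
        (∀ τ', Respects G.legal₁ τ' →
          G.payoff₁ (pureStrategy s) τ' ≤ G.payoff₁ (pureStrategy s) τ)) ∧
      -- (iii) greedy play for the limiting Q-values reproduces exactly the best responses
      (∀ τ', G.IsGreedyStrategy (pureStrategy s) (G.actionValue (pureStrategy s) τ) τ' ↔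
        G.IsBestResponse (pureStrategy s) τ') ∧
      -- (iii) the limiting Q-values are a fixed point of the expected Q-learning update that is
      -- stable (take `δ = 0` for the fixed point) and globally attracting
      (∀ c ∈ Set.Ioo (0 : ℝ) 1, ∀ Q : Table I₀ I₁ A,
        (∀ δ : ℝ,
          (∀ h, G.Reachable₁ (pureStrategy s) h → ∀ a ∈ G.legal₁ h,
            |Q (Sum.inr h) a - G.actionValue (pureStrategy s) τ h a| ≤ δ) →
          ∀ n : ℕ, ∀ h, G.Reachable₁ (pureStrategy s) h → ∀ a ∈ G.legal₁ h,
            |(meanUpdate g ε hε1 c)^[n] Q (Sum.inr h) a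
              - G.actionValue (pureStrategy s) τ h a| ≤ δ) ∧
        (∀ h, G.Reachable₁ (pureStrategy s) h → ∀ a ∈ G.legal₁ h,
          Tendsto (fun n => (meanUpdate g ε hε1 c)^[n] Q (Sum.inr h) a) atTop
            (𝓝 (G.actionValue (pureStrategy s) τ h a)))) ∧
      -- (iii) almost surely, greedy play for the learned Q-values is eventually a best response
      (RobbinsMonro α →
        ∀ᵐ ω ∂(trainingLaw g ε hε1 α Q₀), ∀ᶠ t in atTop, ∀ τ',
          G.IsGreedyStrategy (pureStrategy s) (fun h => (memoryAt M α Q₀ ω t).Q (Sum.inr h)) τ' →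
            G.IsBestResponse (pureStrategy s) τ') := by
  obtain ⟨seq, hG⟩ := hrecall.exists_recalls
  have hF := forced_of_CACw_eq_zero g hε1 Q₀ hε0 hCAC hs
  have hσ := M.respects_pureStrategy hs
  obtain ⟨V, hV⟩ := Game.exists_isOptimal hG hσ
  refine ⟨⟨fun ω t h hh => keep_eq_of_reachProb_pos g hε1 _ hF hh, fun ω h hk a => ?_⟩, ?_,
    fun τ hτ => ?_⟩
  -- With a single retained action the policy is already the forced one in every episode, so the
  -- sequence is constant.
  · simp_rw [playAt, epsGreedy_eq_pure g hε1 _ hk]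
    exact tendsto_const_nhds
  · obtain ⟨τ, hτ⟩ := G.exists_isGreedyStrategy (pureStrategy s) (G.bellman (pureStrategy s) V)
    exact ⟨τ, hV.isBestResponse hG hσ hτ⟩
  have hq : ∀ h, ∀ a ∈ G.legal₁ h, G.actionValue (pureStrategy s) τ h a
      = G.bellman (pureStrategy s) V h a := fun h a ha => hτ.actionValue_eq hG hσ hV ha
  have hiff : ∀ τ', G.IsGreedyStrategy (pureStrategy s) (G.actionValue (pureStrategy s) τ) τ' ↔
      G.IsBestResponse (pureStrategy s) τ' := fun τ' =>
    Game.isGreedyStrategy_iff_isBestResponse hG hσ hV hτ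
  have hconv : RobbinsMonro α → ∀ᵐ ω ∂(trainingLaw g ε hε1 α Q₀),
      ∀ h, G.Reachable₁ (pureStrategy s) h → ∀ a ∈ G.legal₁ h,
        Tendsto (fun t => (memoryAt M α Q₀ ω t).Q (Sum.inr h) a) atTop
          (𝓝 (G.actionValue (pureStrategy s) τ h a)) := fun hRM => by
    filter_upwards [ae_tendsto_memoryAt g hε1 Q₀ hG hs hF hε0 hα hRM hV] with ω hω h hh a ha
    rw [hq h a ha]
    exact hω h hh a ha
  -- A victim deviation within the mask does not change the payoff at all, hence `.le` of an
  -- equality.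
  refine ⟨hconv, ⟨fun σ' hσ' => (hF.value_eq hσ' hτ.legal).le, hτ.overall⟩, hiff,
    fun c hc Q => ⟨fun δ hδ n h hh a ha => ?_, fun h hh a ha => ?_⟩, fun hRM => ?_⟩
  · rw [hq h a ha]
    refine abs_iterate_meanUpdate_sub_le g hε1 hG hs hF hV hc (fun k hk b hb => ?_) n h hh a ha
    rw [← hq k b hb]
    exact hδ k hk b hb
  · rw [hq h a ha]
    exact tendsto_iterate_meanUpdate g hε1 hG hs hF hV hc hε0 Q h hh a ha
  · filter_upwards [hconv hRM] with ω hω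
    filter_upwards [Game.eventually_isGreedyStrategy hω] with t ht τ' hτ'
    exact (hiff τ').1 (ht τ' hτ')
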